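/- All graphs are finite and simple. The Wiener index of a connected graph $G$ is $W(G)=\sum_{\{x,y\}\subseteq V(G)} d_G(x,y)$, the sum of the distances over all unordered pairs of vertices. A block of $G$ is a maximal nonseparable subgraph of $G$, where a graph on at least two vertices is nonseparable if it is connected and has no cut-vertex. Write $P_m$ and $C_m$ for the path and the cycle on $m$ vertices, with the convention $C_2=K_2$, and write $G=G_1\circ_v G_2$ if $G=G_1\cup G_2$ and $G_1\cap G_2=\{v\}$. Let $n$ and $p$ be integers with $n>p>1$. Then there are integers $a\ge 2$ and $b\ge 2$ with $a+b=n-p+3$ such that the graph $$C_a\circ_u P_{p-1}\circ_v C_b,$$ where $u$ and $v$ are the two endvertices of $P_{p-1}$ (distinct if $p\ge 3$, and $u=v$ the only vertex of $P_1$ if $p=2$), is a connected graph on $n$ vertices with exactly $p$ blocks, and it has the maximum Wiener index among all connected graphs on $n$ vertices with exactly $p$ blocks. -/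

import Mathlib

namespace SimpleGraph

variable {V : Type*}

/-- The Wiener index of a graph: the sum of the distances over all unordered pairs of vertices
(the degenerate pairs `{v, v}` contribute `0`). -/
noncomputable def wienerIndex [Fintype V] [DecidableEq V] (G : SimpleGraph V) : ℕ :=
  ∑ e : Sym2 V, Sym2.lift ⟨G.dist, fun _ _ => G.dist_comm⟩ e

/-- `v` is a cut-vertex of `G`: deleting `v` separates two other vertices of the same
connected component of `G`. -/
def IsCutVertex (G : SimpleGraph V) (v : V) : Prop :=
  ∃ (x y : V) (hx : x ≠ v) (hy : y ≠ v),
    G.Reachable x y ∧ ¬ (G.induce {w | w ≠ v}).Reachable ⟨x, hx⟩ ⟨y, hy⟩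

/-- A graph is nonseparable if it is connected and has no cut-vertex; the one-vertex graph is
excluded, so that a nonseparable graph is either 2-connected or `K₂`. -/
def IsNonseparable (G : SimpleGraph V) : Prop :=
  Nontrivial V ∧ G.Connected ∧ ∀ v, ¬ G.IsCutVertex v

/-- A block of `G` is a maximal nonseparable subgraph of `G`. -/
def IsBlock (G : SimpleGraph V) (H : G.Subgraph) : Prop :=
  Maximal (fun K : G.Subgraph => K.coe.IsNonseparable) H

/-- The number of blocks of `G`. -/
noncomputable def numBlocks (G : SimpleGraph V) : ℕ :=
  {H : G.Subgraph | G.IsBlock H}.ncard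

/-- `L = H ∘_v K` for subgraphs of a common graph: `L` is the union of `H` and `K`, and the
intersection of `H` and `K` is the single vertex `v`. -/
def IsVertexGluing {G : SimpleGraph V} (L H K : G.Subgraph) (v : V) : Prop :=
  L = H ⊔ K ∧ H ⊓ K = G.singletonSubgraph v

/-- `G = C_a ∘_u P_m ∘_v C_b`, where `u` and `v` are the first and the last vertex of the path
`P_m` on `m` vertices (two distinct vertices if `m ≥ 2`, the same vertex if `m = 1`).
Here `cycleGraph 2` is the complete graph on two vertices. -/
def IsCyclePathCycle (G : SimpleGraph V) (a m b : ℕ) : Prop :=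
  ∃ (A P B : G.Subgraph) (u v : P.verts) (φ : P.coe ≃g pathGraph m),
    Nonempty (A.coe ≃g cycleGraph a) ∧ Nonempty (B.coe ≃g cycleGraph b) ∧
    (φ u : ℕ) = 0 ∧ (φ v : ℕ) + 1 = m ∧
    IsVertexGluing (A ⊔ P) A P u ∧ IsVertexGluing ⊤ (A ⊔ P) B v

end SimpleGraph

/-! Let every vertex of a graph carry inert weight and a lollipop. A lollipop with parameters `q`,
`t` contributes `q` blocks and `q + t` vertices besides its root. Distances then add up along roots,
so the total distance `loadedSum` is a weighted quadratic sum over the graph plus one term `lolVal`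
per lollipop, and it suffices to simplify the load while keeping the numbers of blocks and vertices.

Two moves drive the proof. Merging: two lollipops that are light compared with the total weight can
be moved to one of their two roots and fused, with parameters added (`lolVal_merge`,
`exists_merge`). Straightening: a nonseparable graph on `b` vertices has transmissions at most `⌊b²
/ 4⌋` and diameter at most `b / 2`, because its inner distance layers have at least two vertices.
Hence it is no better than a cycle, and a cycle between a heavy vertex and a lollipop is no better
than an edge whose `b - 2` spare vertices go to the end cycle (`cycle_lollipop_le`).

Induction along cut-vertices gives two bounds. Seen from a vertex heavier than all the rest, a
loaded graph is dominated by one lollipop (`rootBound`). Without inert weight it is dominated by two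
lollipops with a common root (`twoLollipopBound`): at a cut-vertex either one side is light and
becomes a lollipop, or the lollipop at the cut-vertex is a third load, and the two lightest of the
three are merged.

Two lollipops with a common root are two cycles joined by a path. Sliding the root along the path
does not change the total (`lolVal_add_eq`), so only the cycle lengths remain free, and the best
choice is a maximum over a finite range. For the extremal graph only lower bounds on distances are
needed. -/

/-! ### Arithmetic of lollipops -/

/-- The transmission of the cycle on `t` vertices, `⌊t² / 4⌋`. -/
def quarterSq (t : ℕ) : ℕ := t * t / 4

lemma quarterSq_double (m : ℕ) : quarterSq (2 * m) = m * m := by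
  unfold quarterSq
  rw [show 2 * m * (2 * m) = 4 * (m * m) by ring]
  simp

lemma quarterSq_double_add_one (m : ℕ) : quarterSq (2 * m + 1) = m * m + m := by
  unfold quarterSq
  rw [show (2 * m + 1) * (2 * m + 1) = 1 + 4 * (m * m + m) by ring]
  omega

/-- Transmission of the root of the lollipop with parameters `q`, `t`: a path with `q - 1` edges
starting at the root, followed by a cycle on `t + 2` vertices. -/
def lolTrans (q t : ℕ) : ℚ := q * (q + 1) / 2 + q * t + quarterSq t

/-- Sum of the distances over the ordered pairs of non-root vertices of a lollipop. -/
def lolInner (q t : ℕ) : ℚ :=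
  (q + 1) * q * (q - 1) / 3 + (t + 2 * q) * (quarterSq t + t + 1) + (t + 1) * q * (q - 1)
    - 2 * lolTrans q t

/-- Contribution of a lollipop attached to a graph of total weight `N`. -/
def lolVal (N : ℚ) (q t : ℕ) : ℚ := lolInner q t + 2 * (N - q - t) * lolTrans q t

lemma lolVal_zero (N : ℚ) : lolVal N 0 0 = 0 := by
  simp [lolVal, lolInner, lolTrans, quarterSq]

lemma parity_cases (t : ℕ) : ∃ m, t = 2 * m ∨ t = 2 * m + 1 := ⟨t / 2, by omega⟩

/-- The gain in transmission pays for the distance between the two roots that is lost in a merge.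
Once parities are fixed, the difference is a polynomial with nonnegative coefficients. -/
lemma lolTrans_add_ge (q₁ t₁ q₂ t₂ : ℕ) :
    ((q₁ + t₁ : ℚ) * (q₂ + t₂)) ≤
      2 * (lolTrans (q₁ + q₂) (t₁ + t₂) - lolTrans q₁ t₁ - lolTrans q₂ t₂) := by
  obtain ⟨m, rfl | rfl⟩ := parity_cases t₁ <;> obtain ⟨n, rfl | rfl⟩ := parity_cases t₂
  · rw [show 2 * m + 2 * n = 2 * (m + n) by ring]
    simp only [lolTrans, quarterSq_double]
    rw [← sub_nonneg]; push_cast; ring_nf; positivity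
  · rw [show 2 * m + (2 * n + 1) = 2 * (m + n) + 1 by ring]
    simp only [lolTrans, quarterSq_double, quarterSq_double_add_one]
    rw [← sub_nonneg]; push_cast; ring_nf; positivity
  · rw [show 2 * m + 1 + 2 * n = 2 * (m + n) + 1 by ring]
    simp only [lolTrans, quarterSq_double, quarterSq_double_add_one]
    rw [← sub_nonneg]; push_cast; ring_nf; positivity
  · rw [show 2 * m + 1 + (2 * n + 1) = 2 * (m + n + 1) by ring]
    simp only [lolTrans, quarterSq_double, quarterSq_double_add_one]
    rw [← sub_nonneg]; push_cast; ring_nf; positivity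

/-- Before the merge, pairs between the two lollipops are joined through the roots. The loss on
pairs inside the union is at most the transmission gain times the number of vertices involved; this
is the source of the constant 3 in `lolVal_merge`. -/
lemma lolInner_add_ge {q₁ q₂ : ℕ} (t₁ t₂ : ℕ) (h₁ : 0 < q₁) (h₂ : 0 < q₂) :
    0 ≤ lolInner (q₁ + q₂) (t₁ + t₂) - lolInner q₁ t₁ - lolInner q₂ t₂
      - 2 * (q₂ + t₂) * lolTrans q₁ t₁ - 2 * (q₁ + t₁) * lolTrans q₂ t₂
      + (q₁ + t₁ + q₂ + t₂) *
        (lolTrans (q₁ + q₂) (t₁ + t₂) - lolTrans q₁ t₁ - lolTrans q₂ t₂) := by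
  obtain ⟨a, rfl⟩ := Nat.exists_eq_add_of_lt h₁
  obtain ⟨b, rfl⟩ := Nat.exists_eq_add_of_lt h₂
  obtain ⟨m, rfl | rfl⟩ := parity_cases t₁ <;> obtain ⟨n, rfl | rfl⟩ := parity_cases t₂
  · rw [show 2 * m + 2 * n = 2 * (m + n) by ring]
    simp only [lolInner, lolTrans, quarterSq_double]
    push_cast; ring_nf; positivity
  · rw [show 2 * m + (2 * n + 1) = 2 * (m + n) + 1 by ring]
    simp only [lolInner, lolTrans, quarterSq_double, quarterSq_double_add_one]
    push_cast; ring_nf; positivity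
  · rw [show 2 * m + 1 + 2 * n = 2 * (m + n) + 1 by ring]
    simp only [lolInner, lolTrans, quarterSq_double, quarterSq_double_add_one]
    push_cast; ring_nf; positivity
  · rw [show 2 * m + 1 + (2 * n + 1) = 2 * (m + n + 1) by ring]
    simp only [lolInner, lolTrans, quarterSq_double, quarterSq_double_add_one]
    push_cast; ring_nf; positivity

/-- Merging two lollipops attached at distance at most `d` does not decrease the total. -/
lemma lolVal_merge {q₁ q₂ t₁ t₂ : ℕ} (h₁ : 0 < q₁) (h₂ : 0 < q₂) {N d : ℚ} (hd : 0 ≤ d)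
    (hN : 4 * d + 3 * (q₁ + t₁ + q₂ + t₂) ≤ 2 * N) :
    lolVal N q₁ t₁ + lolVal N q₂ t₂ + 2 * (q₁ + t₁) * (q₂ + t₂) * d ≤
      lolVal N (q₁ + q₂) (t₁ + t₂) := by
  have a := lolTrans_add_ge q₁ t₁ q₂ t₂
  have b := lolInner_add_ge t₁ t₂ h₁ h₂
  have c : (0 : ℚ) ≤ (q₁ + t₁ : ℚ) * (q₂ + t₂) := by positivity
  have e := mul_le_mul_of_nonneg_left a (mul_nonneg zero_le_two hd)
  -- Of the coefficient `2 * N` of the transmission gain, `2 * h` is missing because the merged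
  -- lollipop sees less outside weight, `h` pays for inner pairs and `4 * d` for the root distance,
  -- where `h` is the joint size.
  have f : 0 ≤ (2 * N - 4 * d - 3 * (q₁ + t₁ + q₂ + t₂)) *
      (lolTrans (q₁ + q₂) (t₁ + t₂) - lolTrans q₁ t₁ - lolTrans q₂ t₂) :=
    mul_nonneg (by linarith) (by linarith)
  simp only [lolVal]
  push_cast
  nlinarith

/-- A cycle on `b` vertices with a lollipop attached, seen from a vertex of the cycle of large
weight `k + 1`, is dominated by a single lollipop. -/
lemma cycle_lollipop_le {b q t k : ℕ} (hb : 2 ≤ b) (hq : 0 < q) (hk : t ≤ k) :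
    (b * quarterSq b + 2 * k * quarterSq b + 2 * (q + t) * quarterSq b
      + 2 * (q + t) * k * (b / 2 : ℕ) + lolInner q t + 2 * (k + b) * lolTrans q t : ℚ) ≤
    lolInner (q + 1) (t + (b - 2)) + 2 * (k + 1) * lolTrans (q + 1) (t + (b - 2)) := by
  obtain ⟨r, rfl⟩ := Nat.exists_eq_add_of_lt hq
  -- The hypothesis `t ≤ k` enters here: with `k = t + j` the difference has nonnegative
  -- coefficients.
  obtain ⟨j, rfl⟩ := Nat.exists_eq_add_of_le hk
  obtain ⟨c, rfl⟩ := Nat.exists_eq_add_of_le hb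
  rw [Nat.add_sub_cancel_left]
  obtain ⟨m, rfl | rfl⟩ := parity_cases t <;> obtain ⟨n, rfl | rfl⟩ := parity_cases c
  · rw [show (2 + 2 * n) / 2 = n + 1 by omega, show 2 + 2 * n = 2 * (n + 1) by ring,
      show 2 * m + 2 * n = 2 * (m + n) by ring]
    simp only [lolInner, lolTrans, quarterSq_double]
    rw [← sub_nonneg]; push_cast; ring_nf; positivity
  · rw [show (2 + (2 * n + 1)) / 2 = n + 1 by omega,
      show 2 + (2 * n + 1) = 2 * (n + 1) + 1 by ring,
      show 2 * m + (2 * n + 1) = 2 * (m + n) + 1 by ring]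
    simp only [lolInner, lolTrans, quarterSq_double, quarterSq_double_add_one]
    rw [← sub_nonneg]; push_cast; ring_nf; positivity
  · rw [show (2 + 2 * n) / 2 = n + 1 by omega, show 2 + 2 * n = 2 * (n + 1) by ring,
      show 2 * m + 1 + 2 * n = 2 * (m + n) + 1 by ring]
    simp only [lolInner, lolTrans, quarterSq_double, quarterSq_double_add_one]
    rw [← sub_nonneg]; push_cast; ring_nf; positivity
  · rw [show (2 + (2 * n + 1)) / 2 = n + 1 by omega,
      show 2 + (2 * n + 1) = 2 * (n + 1) + 1 by ring,
      show 2 * m + 1 + (2 * n + 1) = 2 * (m + n + 1) by ring]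
    simp only [lolInner, lolTrans, quarterSq_double, quarterSq_double_add_one]
    rw [← sub_nonneg]; push_cast; ring_nf; positivity

/-- The cycle on `t + 2` vertices as a lollipop. -/
lemma lolTrans_one (t : ℕ) : lolTrans 1 t = quarterSq (t + 2) := by
  obtain ⟨m, rfl | rfl⟩ := parity_cases t
  · rw [show 2 * m + 2 = 2 * (m + 1) by ring]
    simp only [lolTrans, quarterSq_double]; push_cast; ring
  · rw [show 2 * m + 1 + 2 = 2 * (m + 1) + 1 by ring]
    simp only [lolTrans, quarterSq_double_add_one]; push_cast; ring

lemma lolInner_one (t : ℕ) : lolInner 1 t = t * quarterSq (t + 2) := by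
  rw [lolInner, lolTrans_one]
  obtain ⟨m, rfl | rfl⟩ := parity_cases t
  · rw [show 2 * m + 2 = 2 * (m + 1) by ring]
    simp only [quarterSq_double]; push_cast; ring
  · rw [show 2 * m + 1 + 2 = 2 * (m + 1) + 1 by ring]
    simp only [quarterSq_double_add_one]; push_cast; ring

/-- A lollipop whose root path has an edge is a pendant edge glued to a shorter lollipop. -/
lemma lolVal_succ (q t : ℕ) (N : ℚ) (hN : N = q + 1 + t + 1) :
    lolVal N (q + 1) t = lolVal N 1 0 + lolVal N q t := by
  subst hN
  simp only [lolVal, lolInner, lolTrans]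
  simp [quarterSq]
  ring

/-! ### Splitting a graph at a vertex -/

namespace SimpleGraph

variable {V : Type*}

/-- `G` is the union of its induced subgraphs on `S` and `T`, which share only the vertex `v`. -/
structure IsSplit (G : SimpleGraph V) (S T : Set V) (v : V) : Prop where
  mem_left : v ∈ S
  mem_right : v ∈ T
  cover : ∀ x, x ∈ S ∨ x ∈ T
  inter : ∀ x, x ∈ S → x ∈ T → x = v
  adj : ∀ x y, G.Adj x y → (x ∈ S ∧ y ∈ S) ∨ (x ∈ T ∧ y ∈ T)

namespace IsSplit

variable {G : SimpleGraph V} {S T : Set V} {v : V}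

lemma symm (h : G.IsSplit S T v) : G.IsSplit T S v :=
  ⟨h.mem_right, h.mem_left, fun x => (h.cover x).symm, fun x a b => h.inter x b a,
    fun x y a => (h.adj x y a).symm⟩

/-- Collapsing `T` to `v` turns a walk into one that is no longer. The vertex `x'` is the image of
the current vertex: it waits at `v` during excursions into `T`. -/
lemma exists_walk (h : G.IsSplit S T v) {x y : V} (p : G.Walk x y) (hy : y ∈ S) (x' : S)
    (hx : x' = x ∨ (x' = v ∧ x ∈ T)) :
    ∃ p' : (G.induce S).Walk x' ⟨y, hy⟩, p'.length ≤ p.length := by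
  induction p generalizing x' with
  | nil =>
    rename_i x
    have : x' = ⟨x, hy⟩ := by
      ext
      rcases hx with hx | ⟨hx, hT⟩
      · exact hx
      · exact hx.trans (h.inter x hy hT).symm
    subst this
    exact ⟨.nil, le_rfl⟩
  | cons hadj p ih =>
    rename_i x z y
    have step : ∀ hz : z ∈ S, (x' : V) = x → ∃ p' : (G.induce S).Walk x' ⟨y, hy⟩,
        p'.length ≤ p.length + 1 := by
      intro hz e
      obtain ⟨p', hp'⟩ := ih hy ⟨z, hz⟩ (Or.inl rfl)
      have ha : (G.induce S).Adj x' ⟨z, hz⟩ := by simpa [e] using hadj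
      exact ⟨.cons ha p', by simpa using hp'⟩
    simp only [Walk.length_cons]
    rcases hx with hx | ⟨hx, hT⟩
    · rcases h.adj _ _ hadj with ⟨_, hz⟩ | ⟨hxT, hz⟩
      · exact step hz hx
      · obtain ⟨p', hp'⟩ := ih hy x' (Or.inr ⟨h.inter x' x'.2 (hx ▸ hxT), hz⟩)
        exact ⟨p', by omega⟩
    · rcases h.adj _ _ hadj with ⟨hxS, hz⟩ | ⟨_, hz⟩
      · exact step hz (by rw [hx, h.inter x hxS hT])
      · obtain ⟨p', hp'⟩ := ih hy x' (Or.inr ⟨hx, hz⟩)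
        exact ⟨p', by omega⟩

lemma connected (h : G.IsSplit S T v) (hG : G.Connected) : (G.induce S).Connected := by
  have : Nonempty S := ⟨⟨v, h.mem_left⟩⟩
  refine ⟨fun x y => ?_⟩
  obtain ⟨p⟩ := hG.preconnected x y
  obtain ⟨p', -⟩ := h.exists_walk p y.2 x (Or.inl rfl)
  exact ⟨p'⟩

lemma dist_left (h : G.IsSplit S T v) (hG : G.Connected) (x y : S) :
    (G.induce S).dist x y = G.dist x y := by
  apply le_antisymm
  · obtain ⟨p, hp⟩ := (hG.preconnected x y).exists_walk_length_eq_dist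
    obtain ⟨p', hp'⟩ := h.exists_walk p y.2 x (Or.inl rfl)
    exact (dist_le p').trans (hp ▸ hp')
  · obtain ⟨p, hp⟩ := ((h.connected hG).preconnected x y).exists_walk_length_eq_dist
    rw [← hp, ← Walk.length_map (Embedding.induce S).toHom p]
    exact dist_le _

lemma dist_add_le (h : G.IsSplit S T v) (hG : G.Connected) {x y : V} (p : G.Walk x y)
    (hx : x ∈ S) (hy : y ∈ T) : G.dist x v + G.dist v y ≤ p.length := by
  induction p with
  | nil => rw [h.inter _ hx hy]; simp
  | cons hadj p ih =>
    rename_i x z y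
    by_cases hz : z ∈ S
    · have h1 := ih hz hy
      have h2 := hG.dist_triangle (u := x) (v := z) (w := v)
      rw [dist_eq_one_iff_adj.mpr hadj] at h2
      rw [Walk.length_cons]; omega
    · have hxT : x ∈ T := by
        rcases h.adj _ _ hadj with ⟨_, h'⟩ | ⟨h', _⟩
        · exact absurd h' hz
        · exact h'
      obtain rfl := h.inter x hx hxT
      rw [dist_self, zero_add]
      exact dist_le _

lemma dist_add (h : G.IsSplit S T v) (hG : G.Connected) {x y : V} (hx : x ∈ S) (hy : y ∈ T) :
    G.dist x y = G.dist x v + G.dist v y := by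
  apply le_antisymm hG.dist_triangle
  obtain ⟨p, hp⟩ := (hG.preconnected x y).exists_walk_length_eq_dist
  rw [← hp]
  exact h.dist_add_le hG p hx hy

end IsSplit

/-- A cut-vertex of a connected graph splits it into two proper parts. -/
lemma IsCutVertex.exists_isSplit {G : SimpleGraph V} {v : V} (hv : G.IsCutVertex v) :
    ∃ S T : Set V, G.IsSplit S T v ∧ (∃ x, x ∉ S) ∧ ∃ x, x ∉ T := by
  obtain ⟨x, y, hx, hy, -, hxy⟩ := hv
  -- `R` is the component of `x` after deleting `v`. One side is this component with `v`, the other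
  -- its complement.
  let R : V → Prop := fun w => ∃ hw : w ≠ v, (G.induce {w | w ≠ v}).Reachable ⟨x, hx⟩ ⟨w, hw⟩
  have hR : ∀ a b, G.Adj a b → b ≠ v → R a → R b := by
    rintro a b hab hb ⟨ha, hr⟩
    refine ⟨hb, hr.trans (Adj.reachable ?_)⟩
    simpa using hab
  refine ⟨{w | w = v ∨ R w}, {w | ¬ R w}, ⟨Or.inl rfl, fun ⟨h, _⟩ => h rfl, ?_, ?_, ?_⟩, ⟨y, ?_⟩,
    ⟨x, ?_⟩⟩
  · intro w
    by_cases hw : R w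
    · exact Or.inl (Or.inr hw)
    · exact Or.inr hw
  · rintro w (hw | hw) hw'
    · exact hw
    · exact absurd hw hw'
  · intro a b hab
    simp only [Set.mem_ofPred_eq]
    by_cases ha : a = v <;> by_cases hb : b = v
    · exact absurd (ha.trans hb.symm) hab.ne
    · have := hR b a hab.symm
      tauto
    · have := hR a b hab
      tauto
    · have h1 := hR a b hab hb
      have h2 := hR b a hab.symm ha
      tauto
  · rintro (h | ⟨_, h⟩)
    · exact hy h
    · exact hxy h
  · intro h
    exact h ⟨hx, Reachable.refl _⟩

lemma IsNonseparable.of_iso {W : Type*} {G : SimpleGraph V} {H : SimpleGraph W} (e : G ≃g H)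
    (h : G.IsNonseparable) : H.IsNonseparable := by
  obtain ⟨hn, hc, hv⟩ := h
  refine ⟨e.toEquiv.nontrivial_congr.mp hn, (Iso.connected_iff e).mp hc, ?_⟩
  rintro w ⟨x, y, hx, hy, hr, hnr⟩
  have key : ∀ z : V, z ≠ e.symm w ↔ e z ≠ w := by
    intro z
    rw [not_iff_not]
    exact RelIso.eq_symm_apply e
  refine hv (e.symm w) ⟨e.symm x, e.symm y, fun h => hx (e.symm.injective h),
    fun h => hy (e.symm.injective h), (Iso.reachable_iff (φ := e.symm)).mpr hr, fun h => hnr ?_⟩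
  let f : G.induce {z | z ≠ e.symm w} →g H.induce {z | z ≠ w} :=
    ⟨fun z => ⟨e z, (key z).mp z.2⟩, fun {a b} hab => by simpa using (Iso.map_adj_iff e).mpr hab⟩
  have := h.map f
  convert this using 1
  · ext; simp [f]
  · ext; simp [f]

lemma isNonseparable_iff_of_iso {W : Type*} {G : SimpleGraph V} {H : SimpleGraph W}
    (e : G ≃g H) : G.IsNonseparable ↔ H.IsNonseparable :=
  ⟨fun h => h.of_iso e, fun h => h.of_iso e.symm⟩

lemma numBlocks_of_subsingleton [Subsingleton V] (G : SimpleGraph V) : G.numBlocks = 0 := by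
  unfold numBlocks
  convert Set.ncard_empty G.Subgraph
  ext H
  simp only [Set.mem_ofPred_eq, Set.mem_empty_iff_false, iff_false]
  intro h
  obtain ⟨x, y, hxy⟩ := h.prop.1
  exact hxy (Subsingleton.elim _ _)

lemma IsNonseparable.numBlocks {G : SimpleGraph V} (h : G.IsNonseparable) : G.numBlocks = 1 := by
  unfold SimpleGraph.numBlocks
  rw [Set.ncard_eq_one]
  refine ⟨⊤, ?_⟩
  have ht : (⊤ : G.Subgraph).coe.IsNonseparable := h.of_iso Subgraph.topIso.symm
  ext H
  simp only [Set.mem_ofPred_eq, Set.mem_singleton_iff]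
  constructor
  · intro hH
    exact top_le_iff.mp (hH.le_of_ge ht le_top)
  · rintro rfl
    exact ⟨ht, fun _ _ _ => le_top⟩

end SimpleGraph

/-! ### Blocks of a split graph -/

namespace SimpleGraph

variable {V : Type*}

lemma Reachable.closed {G : SimpleGraph V} {P : V → Prop}
    (h : ∀ a b, G.Adj a b → P a → P b) {a b : V} (hab : G.Reachable a b) (ha : P a) : P b := by
  obtain ⟨p⟩ := hab
  induction p with
  | nil => exact ha
  | cons hadj _ ih => exact ih (h _ _ hadj ha)

namespace IsSplit

variable {G : SimpleGraph V} {S T : Set V} {v : V}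

/-- Otherwise `K` has a vertex strictly on each side, and leaving one side requires `v`: it would be
a cut-vertex of `K`, or `K` would be disconnected if it misses `v`. -/
lemma subset_or_subset (h : G.IsSplit S T v) {K : G.Subgraph} (hK : K.coe.IsNonseparable) :
    K.verts ⊆ S ∨ K.verts ⊆ T := by
  by_contra! hcon
  obtain ⟨x, hx, hxS⟩ := Set.not_subset.mp hcon.1
  obtain ⟨y, hy, hyT⟩ := Set.not_subset.mp hcon.2
  have hyS : y ∈ S := (h.cover y).resolve_right hyT
  have hxv : x ≠ v := fun e => hxS (e ▸ h.mem_left)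
  have hyv : y ≠ v := fun e => hyT (e ▸ h.mem_right)
  have step : ∀ a b, G.Adj a b → b ≠ v → a ∉ S → b ∉ S := by
    intro a b hab hb ha hbS
    rcases h.adj a b hab with ⟨h1, _⟩ | ⟨_, h1⟩
    · exact ha h1
    · exact hb (h.inter b hbS h1)
  have hr := hK.2.1.preconnected ⟨x, hx⟩ ⟨y, hy⟩
  by_cases hv : v ∈ K.verts
  · refine hK.2.2 ⟨v, hv⟩ ⟨⟨x, hx⟩, ⟨y, hy⟩, by simpa using hxv, by simpa using hyv, hr, ?_⟩
    intro hr'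
    refine (Reachable.closed (P := fun z => (z.1.1 : V) ∉ S) ?_ hr' hxS : y ∉ S) hyS
    intro a b hab
    refine step _ _ (K.adj_sub hab) ?_
    intro e
    exact b.2 (Subtype.ext e)
  · refine (Reachable.closed (G := K.coe) (P := fun z => z.1 ∉ S) ?_ hr hxS : y ∉ S) hyS
    intro a b hab
    refine step _ _ (K.adj_sub hab) ?_
    rintro rfl
    exact hv b.2

/-- Subgraphs of an induced subgraph, seen as subgraphs of the whole graph. -/
abbrev ofInduce (G : SimpleGraph V) (S : Set V) (K : (G.induce S).Subgraph) : G.Subgraph :=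
  K.map (Embedding.induce S : G.induce S ↪g G).toHom

lemma ofInduce_verts_subset (K : (G.induce S).Subgraph) : (ofInduce G S K).verts ⊆ S := by
  rintro _ ⟨x, -, rfl⟩
  exact x.2

lemma isNonseparable_ofInduce (K : (G.induce S).Subgraph) :
    (ofInduce G S K).coe.IsNonseparable ↔ K.coe.IsNonseparable :=
  (isNonseparable_iff_of_iso
    (Copy.isoSubgraphMap (Embedding.induce S : G.induce S ↪g G).toCopy K)).symm

lemma exists_ofInduce {K : G.Subgraph} (hK : K.verts ⊆ S) : ∃ K', ofInduce G S K' = K := by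
  refine ⟨K.comap (Embedding.induce S : G.induce S ↪g G).toHom, ?_⟩
  ext x y
  · simp only [Subgraph.map_verts, Subgraph.comap_verts, Set.mem_image, Set.mem_preimage]
    constructor
    · rintro ⟨z, hz, rfl⟩; exact hz
    · intro hx; exact ⟨⟨x, hK hx⟩, hx, rfl⟩
  · simp only [Subgraph.map_adj, Relation.Map, Subgraph.comap_adj]
    constructor
    · rintro ⟨a, b, ⟨-, hab⟩, rfl, rfl⟩; exact hab
    · intro hxy
      exact ⟨⟨x, hK (K.edge_vert hxy)⟩, ⟨y, hK (K.edge_vert hxy.symm)⟩,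
        ⟨by simpa using K.adj_sub hxy, hxy⟩, rfl, rfl⟩

lemma ofInduce_le_iff {K K' : (G.induce S).Subgraph} :
    ofInduce G S K ≤ ofInduce G S K' ↔ K ≤ K' := by
  refine ⟨fun h => ⟨fun x hx => ?_, fun x y hxy => ?_⟩, fun h => Subgraph.map_mono h⟩
  · obtain ⟨z, hz, hzx⟩ := h.1 ⟨x, hx, rfl⟩
    rwa [← (Embedding.induce S : G.induce S ↪g G).injective hzx]
  · obtain ⟨a, b, hab, ha, hb⟩ := h.2 ⟨x, y, hxy, rfl, rfl⟩
    rwa [← (Embedding.induce S : G.induce S ↪g G).injective ha,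
      ← (Embedding.induce S : G.induce S ↪g G).injective hb]

lemma not_subset_right (h : G.IsSplit S T v) {K : G.Subgraph} (hK : K.coe.IsNonseparable)
    (hS : K.verts ⊆ S) : ¬ K.verts ⊆ T := by
  intro hT
  obtain ⟨x, y, hxy⟩ := hK.1
  exact hxy (Subtype.ext ((h.inter _ (hS x.2) (hT x.2)).trans
    (h.inter _ (hS y.2) (hT y.2)).symm))

/-- Maximality is the same on both levels, since a nonseparable subgraph above `K` cannot lie in
`T`: `K` has two vertices in `S`, and the sides share only one. -/
lemma isBlock_ofInduce (h : G.IsSplit S T v) {K : (G.induce S).Subgraph} :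
    G.IsBlock (ofInduce G S K) ↔ (G.induce S).IsBlock K := by
  constructor
  · intro hK
    refine ⟨(isNonseparable_ofInduce K).mp hK.prop, fun K' hK' hle => ?_⟩
    exact ofInduce_le_iff.mp
      (hK.le_of_ge ((isNonseparable_ofInduce K').mpr hK') (ofInduce_le_iff.mpr hle))
  · intro hK
    have hn := (isNonseparable_ofInduce K).mpr hK.prop
    refine ⟨hn, fun L hL hle => ?_⟩
    rcases h.subset_or_subset hL with hS | hT
    · obtain ⟨K', rfl⟩ := exists_ofInduce hS
      exact ofInduce_le_iff.mpr
        (hK.le_of_ge ((isNonseparable_ofInduce K').mp hL) (ofInduce_le_iff.mp hle))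
    · exact absurd (hle.1.trans hT) (h.not_subset_right hn (ofInduce_verts_subset K))

lemma numBlocks_eq [Finite V] (h : G.IsSplit S T v) :
    G.numBlocks = (G.induce S).numBlocks + (G.induce T).numBlocks := by
  have inj : ∀ S : Set V, Function.Injective (ofInduce G S) := fun S K K' e =>
    le_antisymm (ofInduce_le_iff.mp e.le) (ofInduce_le_iff.mp e.ge)
  unfold numBlocks
  rw [← Set.ncard_image_of_injective {H | (G.induce S).IsBlock H} (inj S),
    ← Set.ncard_image_of_injective {H | (G.induce T).IsBlock H} (inj T),
    ← Set.ncard_union_eq ?_ (Set.toFinite _) (Set.toFinite _)]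
  · congr 1
    ext K
    simp only [Set.mem_ofPred_eq, Set.mem_union, Set.mem_image]
    constructor
    · intro hK
      rcases h.subset_or_subset hK.prop with hS | hT
      · obtain ⟨K', rfl⟩ := exists_ofInduce hS
        exact Or.inl ⟨K', h.isBlock_ofInduce.mp hK, rfl⟩
      · obtain ⟨K', rfl⟩ := exists_ofInduce hT
        exact Or.inr ⟨K', h.symm.isBlock_ofInduce.mp hK, rfl⟩
    · rintro (⟨K', hK, rfl⟩ | ⟨K', hK, rfl⟩)
      · exact h.isBlock_ofInduce.mpr hK
      · exact h.symm.isBlock_ofInduce.mpr hK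
  · rw [Set.disjoint_left]
    rintro _ ⟨K, hK, rfl⟩ ⟨K', hK', e⟩
    have hn := (isNonseparable_ofInduce K).mpr (show (G.induce S).IsBlock K from hK).prop
    exact h.not_subset_right hn (ofInduce_verts_subset K) (e ▸ ofInduce_verts_subset K')

end IsSplit

/-! ### Distance layers of nonseparable graphs -/

open Classical in
/-- A nonseparable graph has no small distance layers except possibly the last one. -/
lemma IsNonseparable.two_le_layer [Fintype V] {G : SimpleGraph V} (h : G.IsNonseparable)
    (u y : V) {i : ℕ} (hi : 0 < i) (hy : i < G.dist u y) :
    2 ≤ (Finset.univ.filter fun x => G.dist u x = i).card := by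
  have hc := h.2.1
  by_contra! hlt
  have hne : ∃ w, G.dist u w = i := by
    by_contra! hno
    refine absurd hy (not_lt.mpr ?_)
    refine le_of_lt ((hc.preconnected u y).closed (P := fun z => G.dist u z < i) ?_ (by simpa))
    intro a b hab ha
    have := hc.dist_triangle (u := u) (v := a) (w := b)
    rw [dist_eq_one_iff_adj.mpr hab] at this
    have := hno b
    omega
  obtain ⟨w, hw⟩ := hne
  have huniq : ∀ z, G.dist u z = i → z = w := fun z hz =>
    Finset.card_le_one.mp (Nat.le_of_lt_succ hlt) z (by simpa using hz) w (by simpa using hw)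
  have huw : u ≠ w := by rintro rfl; simp at hw; omega
  have hyw : y ≠ w := by rintro rfl; omega
  -- Distances to `u` change by at most one along an edge, so a walk avoiding the only vertex `w` of
  -- layer `i` stays below that layer.
  refine h.2.2 w ⟨u, y, huw, hyw, hc.preconnected u y, fun hr => ?_⟩
  refine absurd (Reachable.closed (P := fun z => G.dist u z.1 < i) ?_ hr (by simpa) :
    G.dist u y < i) (not_lt.mpr hy.le)
  intro a b hab ha
  have := hc.dist_triangle (u := u) (v := a) (w := b)
  rw [dist_eq_one_iff_adj.mpr (show G.Adj a b from hab)] at this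
  have : G.dist u b ≠ i := fun e => b.2 (huniq b e)
  omega

-- The root and two vertices in each of the layers `1, …, i` are excluded. If nothing lies beyond
-- layer `i`, the bound is trivial, which is where truncated subtraction is harmless.
open Classical in
lemma IsNonseparable.card_le_dist [Fintype V] {G : SimpleGraph V} (h : G.IsNonseparable)
    (u : V) (i : ℕ) :
    (Finset.univ.filter fun x => i + 1 ≤ G.dist u x).card ≤ Fintype.card V - 1 - 2 * i := by
  induction i with
  | zero =>
    rw [← Finset.card_univ, ← Finset.card_erase_of_mem (Finset.mem_univ u)]
    refine Finset.card_le_card fun x hx => ?_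
    simp only [Finset.mem_filter, Finset.mem_univ, true_and] at hx
    simp only [Finset.mem_erase, Finset.mem_univ, and_true]
    rintro rfl
    simp at hx
  | succ i ih =>
    rcases (Finset.univ.filter fun x => i + 1 + 1 ≤ G.dist u x).eq_empty_or_nonempty with he | ⟨y, hy⟩
    · rw [he]; simp
    · simp only [Finset.mem_filter, Finset.mem_univ, true_and] at hy
      have h2 := h.two_le_layer u y (Nat.add_one_pos i) hy
      have : (Finset.univ.filter fun x => i + 1 ≤ G.dist u x).card =
          (Finset.univ.filter fun x => i + 1 + 1 ≤ G.dist u x).card +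
          (Finset.univ.filter fun x => G.dist u x = i + 1).card := by
        rw [← Finset.card_union_of_disjoint]
        · congr 1
          ext x
          simp only [Finset.mem_filter, Finset.mem_univ, true_and, Finset.mem_union]
          omega
        · rw [Finset.disjoint_filter]
          intro x _ h1 h2
          omega
      omega

lemma IsNonseparable.dist_le_half [Fintype V] {G : SimpleGraph V} (h : G.IsNonseparable)
    (u x : V) : G.dist u x ≤ Fintype.card V / 2 := by
  classical
  rcases Nat.eq_zero_or_pos (G.dist u x) with h0 | h0
  · omega
  · have := h.card_le_dist u (G.dist u x - 1)
    have h1 : 0 < (Finset.univ.filter fun z => G.dist u x - 1 + 1 ≤ G.dist u z).card :=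
      Finset.card_pos.mpr ⟨x, by simp; omega⟩
    omega

lemma sum_range_tsub (n : ℕ) : ∑ i ∈ Finset.range n, (n - 1 - 2 * i) = quarterSq n := by
  induction n using Nat.twoStepInduction with
  | zero => simp [quarterSq]
  | one => simp [quarterSq]
  | more n ih _ =>
    rw [Finset.sum_range_succ', Finset.sum_range_succ]
    have : ∀ i ∈ Finset.range n, n + 2 - 1 - 2 * (i + 1) = n - 1 - 2 * i := by
      intro i _; omega
    rw [Finset.sum_congr rfl this, ih]
    obtain ⟨m, rfl | rfl⟩ := parity_cases n
    · rw [show 2 * m + 2 = 2 * (m + 1) by ring, quarterSq_double, quarterSq_double]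
      have : (m + 1) * (m + 1) = m * m + 2 * m + 1 := by ring
      omega
    · rw [show 2 * m + 1 + 2 = 2 * (m + 1) + 1 by ring, quarterSq_double_add_one,
        quarterSq_double_add_one]
      have : (m + 1) * (m + 1) = m * m + 2 * m + 1 := by ring
      omega

/-- A distance is the number of thresholds `i + 1` it reaches; exchanging the sums reduces the claim
to `card_le_dist` and `sum_range_tsub`. -/
lemma IsNonseparable.sum_dist_le [Fintype V] {G : SimpleGraph V} (h : G.IsNonseparable)
    (u : V) : ∑ x, G.dist u x ≤ quarterSq (Fintype.card V) := by
  classical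
  have hd : ∀ x, G.dist u x =
      ∑ i ∈ Finset.range (Fintype.card V), if i + 1 ≤ G.dist u x then 1 else 0 := by
    intro x
    have hx : G.dist u x ≤ Fintype.card V := (h.dist_le_half u x).trans (Nat.div_le_self _ _)
    rw [← Finset.card_filter]
    conv_lhs => rw [← Finset.card_range (G.dist u x)]
    congr 1
    ext i
    simp only [Finset.mem_range, Finset.mem_filter]
    omega
  rw [Finset.sum_congr rfl fun x _ => hd x, Finset.sum_comm, ← sum_range_tsub]
  refine Finset.sum_le_sum fun i _ => ?_
  rw [← Finset.card_filter]
  exact h.card_le_dist u i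

end SimpleGraph

/-! ### Weighted distance sums and loaded graphs -/

/-- Sum of `w x * w y * d x y` over the ordered pairs. -/
def quadSum {V : Type*} [Fintype V] (d : V → V → ℚ) (w : V → ℚ) : ℚ :=
  ∑ x, ∑ y, w x * w y * d x y

lemma quadSum_add_single {V : Type*} [Fintype V] [DecidableEq V] {d : V → V → ℚ}
    (hd : ∀ x y, d x y = d y x) {v : V} (hv : d v v = 0) (w : V → ℚ) (c : ℚ) :
    quadSum d (fun x => w x + (Pi.single v c : V → ℚ) x) = quadSum d w + 2 * c * ∑ y, w y * d v y := by
  have e : ∀ x y, (w x + (Pi.single v c : V → ℚ) x) * (w y + (Pi.single v c : V → ℚ) y) * d x y =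
      w x * w y * d x y + (Pi.single v c : V → ℚ) x * (w y * d v y)
        + (Pi.single v c : V → ℚ) y * (w x * d v x) := by
    intro x y
    by_cases hx : x = v <;> by_cases hy : y = v
    · subst hx; subst hy; simp [hv]
    · subst hx; simp [hy]; ring
    · subst hy; simp [hx, hd x y]; ring
    · simp [hx, hy]
  unfold quadSum
  simp only [e, Finset.sum_add_distrib, ← Finset.mul_sum, ← Finset.sum_mul]
  have e1 : ∑ x, (Pi.single v c : V → ℚ) x = c := by simp
  simp only [e1]
  ring

lemma sum_add_eq_of_cover {V : Type*} [Fintype V] {S T : Set V} [Fintype S] [Fintype T] {v : V}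
    (hS : v ∈ S) (hT : v ∈ T) (cover : ∀ x, x ∈ S ∨ x ∈ T) (inter : ∀ x, x ∈ S → x ∈ T → x = v)
    {M : Type*} [AddCommMonoid M] (f : V → M) :
    ∑ x, f x + f v = ∑ x : S, f x + ∑ x : T, f x := by
  classical
  have hu : S.toFinset ∪ T.toFinset = Finset.univ := by ext x; simpa using cover x
  have hi : S.toFinset ∩ T.toFinset = {v} := by
    ext x
    simp only [Finset.mem_inter, Set.mem_toFinset, Finset.mem_singleton]
    exact ⟨fun h => inter x h.1 h.2, fun h => h ▸ ⟨hS, hT⟩⟩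
  have := Finset.sum_union_inter (s₁ := S.toFinset) (s₂ := T.toFinset) (f := f)
  rw [hu, hi, Finset.sum_singleton] at this
  rw [this, Finset.sum_subtype S.toFinset (fun x => Set.mem_toFinset) f,
    Finset.sum_subtype T.toFinset (fun x => Set.mem_toFinset) f]

namespace SimpleGraph

variable {V : Type*}

/-- The distance of a graph, as a rational number. -/
noncomputable def qdist (G : SimpleGraph V) (x y : V) : ℚ := G.dist x y

lemma qdist_comm (G : SimpleGraph V) (x y : V) : G.qdist x y = G.qdist y x := by
  simp [qdist, dist_comm]

@[simp] lemma qdist_self (G : SimpleGraph V) (x : V) : G.qdist x x = 0 := by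
  simp [qdist]

/-- Weight of a vertex carrying `k` inert units and a lollipop with parameters `q` and `t`. -/
def weight (k q t : V → ℕ) (x : V) : ℕ := 1 + k x + q x + t x

/-- Sum of the weighted distances over the ordered pairs of vertices of the graph obtained from
`G` by attaching, at each vertex `x`, `k x` inert units and a lollipop with parameters `q x` and
`t x`. -/
noncomputable def loadedSum [Fintype V] (G : SimpleGraph V) (k q t : V → ℕ) : ℚ :=
  quadSum G.qdist (fun x => weight k q t x)
    + ∑ x, lolVal (∑ y, weight k q t y : ℕ) (q x) (t x)

namespace IsSplit

variable {G : SimpleGraph V} {S T : Set V} {v : V}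

lemma sum_add [Fintype V] [Fintype S] [Fintype T] (h : G.IsSplit S T v) {M : Type*}
    [AddCommMonoid M] (f : V → M) : ∑ x, f x + f v = ∑ x : S, f x + ∑ x : T, f x :=
  sum_add_eq_of_cover h.mem_left h.mem_right h.cover h.inter f

lemma quadSum_row [Fintype V] [Fintype S] [Fintype T] (h : G.IsSplit S T v) (hG : G.Connected)
    (w : V → ℚ) {x : V} (hx : x ∈ S) :
    ∑ y, w y * G.qdist x y = ∑ y : S, w y * G.qdist x y
      + (∑ y : T, w y - w v) * G.qdist x v + ∑ y : T, w y * G.qdist v y := by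
  have e1 := h.sum_add (fun y => w y * G.qdist x y)
  have e2 : ∑ y : T, w y * G.qdist x y =
      (∑ y : T, w y) * G.qdist x v + ∑ y : T, w y * G.qdist v y := by
    rw [Finset.sum_mul, ← Finset.sum_add_distrib]
    refine Finset.sum_congr rfl fun y _ => ?_
    simp only [qdist, h.dist_add hG hx y.2]
    push_cast; ring
  rw [e2] at e1
  linarith

lemma quadSum_eq [Fintype V] [Fintype S] [Fintype T] (h : G.IsSplit S T v) (hG : G.Connected)
    (w : V → ℚ) :
    quadSum G.qdist w =
      quadSum (G.induce S).qdist (fun x => w x)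
        + 2 * (∑ y : T, w y - w v) * ∑ x : S, w x * G.qdist v x
      + (quadSum (G.induce T).qdist (fun x => w x)
        + 2 * (∑ y : S, w y - w v) * ∑ x : T, w x * G.qdist v x) := by
  have eS : quadSum (G.induce S).qdist (fun x => w x) =
      ∑ x : S, w x * ∑ y : S, w y * G.qdist x y := by
    simp only [quadSum, qdist, h.dist_left hG, Finset.mul_sum, mul_assoc]
  have eT : quadSum (G.induce T).qdist (fun x => w x) =
      ∑ x : T, w x * ∑ y : T, w y * G.qdist x y := by
    simp only [quadSum, qdist, h.symm.dist_left hG, Finset.mul_sum, mul_assoc]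
  have e0 : quadSum G.qdist w = ∑ x, w x * ∑ y, w y * G.qdist x y := by
    simp only [quadSum, Finset.mul_sum, mul_assoc]
  have e1 := h.sum_add (fun x => w x * ∑ y, w y * G.qdist x y)
  rw [Finset.sum_congr rfl fun (x : S) _ => congrArg (w x * ·) (h.quadSum_row hG w x.2),
    Finset.sum_congr rfl fun (x : T) _ => congrArg (w x * ·) (h.symm.quadSum_row hG w x.2),
    h.quadSum_row hG w h.mem_left] at e1
  simp only [mul_add, Finset.sum_add_distrib, ← Finset.sum_mul, qdist_self, mul_zero] at e1
  have f1 : ∑ x : S, w x * ((∑ y : T, w y - w v) * G.qdist x v) =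
      (∑ y : T, w y - w v) * ∑ x : S, w x * G.qdist v x := by
    rw [Finset.mul_sum]
    refine Finset.sum_congr rfl fun x _ => ?_
    rw [qdist_comm]; ring
  have f2 : ∑ x : T, w x * ((∑ y : S, w y - w v) * G.qdist x v) =
      (∑ y : S, w y - w v) * ∑ x : T, w x * G.qdist v x := by
    rw [Finset.mul_sum]
    refine Finset.sum_congr rfl fun x _ => ?_
    rw [qdist_comm]; ring
  rw [f1, f2] at e1
  rw [e0, eS, eT]
  linarith

/-- All distances between the sides pass through `v`, so each side sees the other as a point mass at
`v`. -/
lemma quadSum_eq_add [Fintype V] [Fintype S] [Fintype T] [DecidableEq V] (h : G.IsSplit S T v)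
    (hG : G.Connected) (w : V → ℚ) :
    quadSum G.qdist w =
      quadSum (G.induce S).qdist
        (fun x : S => w x + (Pi.single (⟨v, h.mem_left⟩ : S) (∑ y : T, w y - w v) : S → ℚ) x)
      + quadSum (G.induce T).qdist
        (fun x : T => w x + (Pi.single (⟨v, h.mem_right⟩ : T) (∑ y : S, w y - w v) : T → ℚ) x) := by
  rw [h.quadSum_eq hG, quadSum_add_single (qdist_comm _) (qdist_self _ _),
    quadSum_add_single (qdist_comm _) (qdist_self _ _)]
  simp only [qdist, h.dist_left hG, h.symm.dist_left hG]

/-- Splitting a loaded graph at a vertex. The lollipop at the common vertex stays on the side of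
`T`. -/
lemma loadedSum_eq [Fintype V] [Fintype S] [Fintype T] [DecidableEq V] (h : G.IsSplit S T v)
    (hG : G.Connected) {k q t : V → ℕ} (hk : ∀ x ∈ T, x ≠ v → k x = 0) {K H : ℕ}
    (hH : H + 1 = ∑ x : T, (1 + q x + t x)) (hK : K + H + 1 = ∑ x, weight k q t x) :
    G.loadedSum k q t =
      (G.induce S).loadedSum (fun x => k x + (Pi.single ⟨v, h.mem_left⟩ H : S → ℕ) x)
        (Function.update (fun x => q x) ⟨v, h.mem_left⟩ 0)
        (Function.update (fun x => t x) ⟨v, h.mem_left⟩ 0)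
      + (G.induce T).loadedSum (Pi.single ⟨v, h.mem_right⟩ K) (fun x => q x) (fun x => t x) := by
  set vS : S := ⟨v, h.mem_left⟩
  set vT : T := ⟨v, h.mem_right⟩
  have hN := h.sum_add (weight k q t)
  have hT : ∑ x : T, weight k q t x = H + 1 + k v := by
    have : ∀ x : T, weight k q t x = (1 + q x + t x) + (Pi.single vT (k v) : T → ℕ) x := by
      intro x
      by_cases hx : x = vT
      · subst hx; simp [weight, vT]; ring
      · have : (x : V) ≠ v := fun e => hx (Subtype.ext e)
        simp [weight, hx, hk x x.2 this]
    rw [Finset.sum_congr rfl fun x _ => this x, Finset.sum_add_distrib, ← hH]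
    simp
  -- `H` counts the vertices and lollipops of `T` without the single unit of `v`, hence includes the
  -- lollipop at `v`; this is why that lollipop is erased on the side of `S`.
  have hwS : ∀ x : S, (weight (fun x : S => k x + (Pi.single vS H : S → ℕ) x)
      (Function.update (fun x : S => q x) vS 0) (Function.update (fun x : S => t x) vS 0) x : ℚ)
      = weight k q t x + (Pi.single vS (∑ y : T, (weight k q t y : ℚ) - weight k q t v) : S → ℚ) x
      := by
    intro x
    have hT' : ∑ y : T, (weight k q t y : ℚ) = H + 1 + k v := by exact_mod_cast hT
    rw [hT']
    by_cases hx : x = vS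
    · subst hx; simp [weight, vS]; ring
    · simp [weight, hx]
  have hwT : ∀ x : T, (weight (Pi.single vT K : T → ℕ) (fun x : T => q x) (fun x : T => t x) x : ℚ)
      = weight k q t x + (Pi.single vT (∑ y : S, (weight k q t y : ℚ) - weight k q t v) : T → ℚ) x
      := by
    intro x
    have hS' : (∑ y : S, (weight k q t y : ℚ)) - weight k q t v = K - k v := by
      have : (∑ y : S, weight k q t y) + k v = K + weight k q t v := by omega
      have : (∑ y : S, (weight k q t y : ℚ)) + k v = K + weight k q t v := by exact_mod_cast this
      linarith
    rw [hS']
    by_cases hx : x = vT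
    · subst hx; simp [weight, vT]; ring
    · have : (x : V) ≠ v := fun e => hx (Subtype.ext e)
      simp [weight, hx, hk x x.2 this]
  have hNS : ∑ x : S, weight (fun x : S => k x + (Pi.single vS H : S → ℕ) x)
      (Function.update (fun x : S => q x) vS 0) (Function.update (fun x : S => t x) vS 0) x
      = ∑ x, weight k q t x := by
    have : (∑ x : S, weight (fun x : S => k x + (Pi.single vS H : S → ℕ) x)
      (Function.update (fun x : S => q x) vS 0) (Function.update (fun x : S => t x) vS 0) x : ℚ)
      = ∑ x, (weight k q t x : ℚ) := by
      rw [Finset.sum_congr rfl fun x _ => hwS x, Finset.sum_add_distrib, Finset.sum_pi_single']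
      have := h.sum_add (fun x => (weight k q t x : ℚ))
      simp only [Finset.mem_univ, if_true]
      linarith
    exact_mod_cast this
  have hNT : ∑ x : T, weight (Pi.single vT K : T → ℕ) (fun x : T => q x) (fun x : T => t x) x
      = ∑ x, weight k q t x := by
    have : (∑ x : T, weight (Pi.single vT K : T → ℕ) (fun x : T => q x) (fun x : T => t x) x : ℚ)
      = ∑ x, (weight k q t x : ℚ) := by
      rw [Finset.sum_congr rfl fun x _ => hwT x, Finset.sum_add_distrib, Finset.sum_pi_single']
      have := h.sum_add (fun x => (weight k q t x : ℚ))
      simp only [Finset.mem_univ, if_true]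
      linarith
    exact_mod_cast this
  unfold loadedSum
  rw [hNS, hNT]
  set N : ℚ := ((∑ x, weight k q t x : ℕ) : ℚ)
  have hL := h.sum_add (fun x => lolVal N (q x) (t x))
  have hLS : ∑ x : S, lolVal N (Function.update (fun x : S => q x) vS 0 x)
      (Function.update (fun x : S => t x) vS 0 x) + lolVal N (q v) (t v) =
      ∑ x : S, lolVal N (q x) (t x) := by
    rw [← Finset.add_sum_erase _ _ (Finset.mem_univ vS),
      ← Finset.add_sum_erase _ (fun x : S => lolVal N (q x) (t x)) (Finset.mem_univ vS)]
    have : ∀ x ∈ Finset.univ.erase vS, lolVal N (Function.update (fun x : S => q x) vS 0 x)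
      (Function.update (fun x : S => t x) vS 0 x) = lolVal N (q x) (t x) := by
      intro x hx
      simp [Finset.ne_of_mem_erase hx]
    rw [Finset.sum_congr rfl this]
    simp [lolVal_zero, vS]
  rw [h.quadSum_eq_add hG, funext hwS, funext hwT]
  linarith

end IsSplit

/-- The lollipop at a vertex can be traded for inert units. -/
lemma loadedSum_absorb [Fintype V] [DecidableEq V] (G : SimpleGraph V) (k q t : V → ℕ) (v : V) :
    G.loadedSum k q t =
      G.loadedSum (fun x => k x + (Pi.single v (q v + t v) : V → ℕ) x) (Function.update q v 0)
        (Function.update t v 0) + lolVal (∑ y, weight k q t y : ℕ) (q v) (t v) := by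
  have hw : weight (fun x => k x + (Pi.single v (q v + t v) : V → ℕ) x) (Function.update q v 0)
        (Function.update t v 0) = weight k q t := by
    funext x
    by_cases hx : x = v
    · subst hx; simp [weight]; ring
    · simp [weight, hx]
  unfold loadedSum
  rw [hw]
  set N : ℚ := ((∑ x, weight k q t x : ℕ) : ℚ)
  rw [← Finset.add_sum_erase _ _ (Finset.mem_univ v),
    ← Finset.add_sum_erase _ (fun x => lolVal N (Function.update q v 0 x)
      (Function.update t v 0 x)) (Finset.mem_univ v)]
  have : ∀ x ∈ Finset.univ.erase v, lolVal N (Function.update q v 0 x)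
      (Function.update t v 0 x) = lolVal N (q x) (t x) := by
    intro x hx
    simp [Finset.ne_of_mem_erase hx]
  rw [Finset.sum_congr rfl this]
  simp [lolVal_zero]
  ring

end SimpleGraph

/-! ### Moving and merging lollipops -/

lemma sum_eq_add_add_compl {V : Type*} [Fintype V] [DecidableEq V] {x y : V} (hxy : x ≠ y)
    {M : Type*} [AddCommMonoid M] (f : V → M) :
    ∑ z, f z = f x + f y + ∑ z ∈ (Finset.univ.erase x).erase y, f z := by
  rw [← Finset.add_sum_erase _ f (Finset.mem_univ x), add_assoc,
    Finset.add_sum_erase _ f (Finset.mem_erase.mpr ⟨hxy.symm, Finset.mem_univ y⟩)]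

lemma sum_single_mul {V : Type*} [Fintype V] [DecidableEq V] (x : V) (c : ℚ) (f : V → ℚ) :
    ∑ z, (Pi.single x c : V → ℚ) z * f z = c * f x := by
  rw [Finset.sum_eq_single x (fun b _ hb => by simp [hb]) (by simp)]
  simp

/-- Move the value of `f` at `y` to `x`. -/
def moveTo {V : Type*} [DecidableEq V] (f : V → ℕ) (x y : V) : V → ℕ :=
  Function.update (Function.update f y 0) x (f x + f y)

section moveTo

variable {V : Type*} [DecidableEq V] (f : V → ℕ) {x y : V}

@[simp] lemma moveTo_left : moveTo f x y x = f x + f y := by simp [moveTo]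

lemma moveTo_right (hxy : x ≠ y) : moveTo f x y y = 0 := by simp [moveTo, hxy.symm]

lemma moveTo_of_ne {z : V} (hx : z ≠ x) (hy : z ≠ y) : moveTo f x y z = f z := by
  simp [moveTo, hx, hy]

lemma sum_moveTo [Fintype V] (hxy : x ≠ y) : ∑ z, moveTo f x y z = ∑ z, f z := by
  rw [sum_eq_add_add_compl hxy, sum_eq_add_add_compl hxy f, moveTo_left, moveTo_right f hxy,
    add_zero]
  congr 1
  refine Finset.sum_congr rfl fun z hz => ?_
  simp only [Finset.mem_erase, Finset.mem_univ, and_true] at hz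
  exact moveTo_of_ne f hz.2 hz.1

end moveTo

namespace SimpleGraph

variable {V : Type*}

lemma sum_weight [Fintype V] (k q t : V → ℕ) :
    ∑ x, weight k q t x = ∑ x, k x + ∑ x, (1 + q x + t x) := by
  rw [← Finset.sum_add_distrib]
  exact Finset.sum_congr rfl fun x _ => by simp only [weight]; ring

lemma sum_size [Fintype V] (q t : V → ℕ) :
    ∑ x, (1 + q x + t x) = Fintype.card V + ∑ x, q x + ∑ x, t x := by
  simp [Finset.sum_add_distrib]

section

variable [Fintype V] {G : SimpleGraph V}

lemma IsNonseparable.sum_qdist_le (h : G.IsNonseparable) (u : V) :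
    ∑ x, G.qdist u x ≤ quarterSq (Fintype.card V) := by
  unfold qdist
  exact_mod_cast h.sum_dist_le u

lemma IsNonseparable.quadSum_one_le (h : G.IsNonseparable) :
    quadSum G.qdist (fun _ => 1) ≤ Fintype.card V * quarterSq (Fintype.card V) := by
  unfold quadSum
  refine (Finset.sum_le_sum fun x _ => ?_).trans_eq
    (by rw [Finset.sum_const, Finset.card_univ, nsmul_eq_mul])
  simpa using h.sum_qdist_le x

lemma IsNonseparable.two_le_card (h : G.IsNonseparable) : 2 ≤ Fintype.card V :=
  Fintype.one_lt_card_iff_nontrivial.mpr h.1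

end

variable [Fintype V] [DecidableEq V]

/-- Moving the lollipop at `y` to `x` and merging it with the one there. -/
lemma loadedSum_le_moveTo (G : SimpleGraph V) (k q t : V → ℕ) {x y : V} (hxy : x ≠ y)
    (hqx : 0 < q x) (hqy : 0 < q y) {δ : ℕ} (hδ : G.dist x y ≤ δ)
    (hN : 4 * δ + 3 * (q x + t x + q y + t y) ≤ 2 * ∑ z, weight k q t z)
    (hA : ∑ z, (weight k (moveTo q x y) (moveTo t x y) z : ℚ) * G.qdist y z
      - (q x + t x + q y + t y) * G.qdist y x ≤
      ∑ z, (weight k (moveTo q x y) (moveTo t x y) z : ℚ) * G.qdist x z) :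
    G.loadedSum k q t ≤ G.loadedSum k (moveTo q x y) (moveTo t x y) := by
  set hx : ℚ := q x + t x
  set hy : ℚ := q y + t y
  -- `β` is the weight with both lollipops removed. Hypothesis `hA` says that its transmission is at
  -- least as large at `x` as at `y`.
  let β : V → ℚ := fun z => (weight k (moveTo q x y) (moveTo t x y) z : ℚ)
    + (Pi.single x (-(hx + hy)) : V → ℚ) z
  have hw' : ∀ z, (weight k (moveTo q x y) (moveTo t x y) z : ℚ) =
      β z + (Pi.single x (hx + hy) : V → ℚ) z := by
    intro z
    by_cases hz : z = x
    · subst hz; simp [β]; ring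
    · simp [β, hz]
  have hw : ∀ z, (weight k q t z : ℚ) =
      (β z + (Pi.single x hx : V → ℚ) z) + (Pi.single y hy : V → ℚ) z := by
    intro z
    by_cases hz : z = x
    · subst hz; simp [β, hxy, weight, hx, hy]; ring
    · by_cases hz' : z = y
      · subst hz'; simp [β, hz, weight, moveTo_right _ hxy, hy]; ring
      · simp [β, hz, hz', weight, moveTo_of_ne]
  have hsum : ∑ z, weight k (moveTo q x y) (moveTo t x y) z = ∑ z, weight k q t z := by
    rw [sum_weight, sum_weight, sum_size, sum_size, sum_moveTo _ hxy, sum_moveTo _ hxy]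
  have hA' : ∑ z, β z * G.qdist y z ≤ ∑ z, β z * G.qdist x z := by
    simp only [hw', add_mul, Finset.sum_add_distrib] at hA
    rw [sum_single_mul, sum_single_mul, qdist_self] at hA
    have : (q x + t x + q y + t y : ℚ) = hx + hy := by simp only [hx, hy]; ring
    linarith
  clear_value β
  unfold loadedSum
  rw [hsum, funext hw, funext hw', quadSum_add_single (qdist_comm _) (qdist_self _ _),
    quadSum_add_single (qdist_comm _) (qdist_self _ _),
    quadSum_add_single (qdist_comm _) (qdist_self _ _)]
  have e : ∑ z, (β z + (Pi.single x hx : V → ℚ) z) * G.qdist y z =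
      ∑ z, β z * G.qdist y z + hx * G.qdist y x := by
    simp only [add_mul, Finset.sum_add_distrib, sum_single_mul]
  rw [e]
  set N : ℚ := ((∑ z, weight k q t z : ℕ) : ℚ)
  rw [sum_eq_add_add_compl hxy (fun z => lolVal N (q z) (t z)),
    sum_eq_add_add_compl hxy (fun z => lolVal N (moveTo q x y z) (moveTo t x y z))]
  have e2 : ∑ z ∈ (Finset.univ.erase x).erase y, lolVal N (moveTo q x y z) (moveTo t x y z) =
      ∑ z ∈ (Finset.univ.erase x).erase y, lolVal N (q z) (t z) := by
    refine Finset.sum_congr rfl fun z hz => ?_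
    simp only [Finset.mem_erase, Finset.mem_univ, and_true] at hz
    rw [moveTo_of_ne _ hz.2 hz.1, moveTo_of_ne _ hz.2 hz.1]
  rw [e2, moveTo_left, moveTo_left, moveTo_right _ hxy, moveTo_right _ hxy, lolVal_zero]
  have hd0 : (0 : ℚ) ≤ δ := by positivity
  have hdδ : G.qdist y x ≤ δ := by
    rw [qdist_comm]; unfold qdist; exact_mod_cast hδ
  have hm := lolVal_merge (t₁ := t x) (t₂ := t y) hqx hqy (N := N) hd0
    (by simp only [N]; exact_mod_cast hN)
  have hhx : 0 ≤ hx := by positivity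
  have hhy : 0 ≤ hy := by positivity
  -- Against the rest the move to `x` loses nothing. The only loss is the distance between the two
  -- lollipops, which `lolVal_merge` recovers.
  have h1 : hy * (∑ z, β z * G.qdist y z) ≤ hy * ∑ z, β z * G.qdist x z :=
    mul_le_mul_of_nonneg_left hA' hhy
  have h2 : hx * hy * G.qdist y x ≤ hx * hy * δ :=
    mul_le_mul_of_nonneg_left hdδ (mul_nonneg hhx hhy)
  have h3 : 2 * (q x + t x : ℚ) * (q y + t y) * δ = 2 * (hx * hy * δ) := by
    simp only [hx, hy]; ring
  rw [h3] at hm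
  nlinarith

/-- The merged lollipop is placed at whichever of `x`, `y` has the larger transmission with respect
to the remaining weight; one of the two directions always qualifies. The decreasing count of
nontrivial lollipops allows induction. -/
lemma exists_merge (G : SimpleGraph V) {k q t : V → ℕ} (hq : ∀ z, q z = 0 → t z = 0) {x y : V}
    (hxy : x ≠ y) (hqx : 0 < q x) (hqy : 0 < q y) {δ : ℕ} (hδ : G.dist x y ≤ δ)
    (hN : 4 * δ + 3 * (q x + t x + q y + t y) ≤ 2 * ∑ z, weight k q t z) :
    ∃ q' t' : V → ℕ, (∀ z, q' z = 0 → t' z = 0) ∧ ∑ z, q' z = ∑ z, q z ∧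
      ∑ z, t' z = ∑ z, t z ∧
      (Finset.univ.filter fun z => 0 < q' z).card < (Finset.univ.filter fun z => 0 < q z).card ∧
      G.loadedSum k q t ≤ G.loadedSum k q' t' := by
  have key : ∀ x y : V, x ≠ y → 0 < q x → 0 < q y → (∀ z, moveTo q x y z = 0 → moveTo t x y z = 0) ∧
      ∑ z, moveTo q x y z = ∑ z, q z ∧ ∑ z, moveTo t x y z = ∑ z, t z ∧
      (Finset.univ.filter fun z => 0 < moveTo q x y z).card <
        (Finset.univ.filter fun z => 0 < q z).card := by
    intro x y hxy hqx hqy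
    refine ⟨fun z => ?_, sum_moveTo _ hxy, sum_moveTo _ hxy, Finset.card_lt_card ?_⟩
    · by_cases hz : z = x
      · subst hz; simp only [moveTo_left]; omega
      · by_cases hz' : z = y
        · subst hz'; simp [moveTo_right _ hxy]
        · simp only [moveTo_of_ne _ hz hz']; exact hq z
    · rw [Finset.ssubset_iff_of_subset]
      · exact ⟨y, by simpa using hqy, by simp [moveTo_right _ hxy]⟩
      · intro z
        simp only [Finset.mem_filter, Finset.mem_univ, true_and]
        by_cases hz : z = x
        · subst hz; intro _; exact hqx
        · by_cases hz' : z = y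
          · subst hz'; intro _; exact hqy
          · rw [moveTo_of_ne _ hz hz']; exact id
  by_cases hA : ∑ z, (weight k (moveTo q x y) (moveTo t x y) z : ℚ) * G.qdist y z
      - (q x + t x + q y + t y) * G.qdist y x ≤
      ∑ z, (weight k (moveTo q x y) (moveTo t x y) z : ℚ) * G.qdist x z
  · obtain ⟨h1, h2, h3, h4⟩ := key x y hxy hqx hqy
    exact ⟨_, _, h1, h2, h3, h4, loadedSum_le_moveTo G k q t hxy hqx hqy hδ hN hA⟩
  · obtain ⟨h1, h2, h3, h4⟩ := key y x hxy.symm hqy hqx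
    refine ⟨_, _, h1, h2, h3, h4, loadedSum_le_moveTo (δ := δ) G k q t hxy.symm hqy hqx
      (by rwa [dist_comm]) (by omega) ?_⟩
    -- The two possible outcomes differ only in the position of the merged mass, so the failure of
    -- `hA` for one direction yields it for the other.
    have e : ∀ a, ∑ z, (weight k (moveTo q y x) (moveTo t y x) z : ℚ) * G.qdist a z =
        ∑ z, (weight k (moveTo q x y) (moveTo t x y) z : ℚ) * G.qdist a z
        + (q x + t x + q y + t y) * G.qdist a y - (q x + t x + q y + t y) * G.qdist a x := by
      intro a
      have : ∀ z, (weight k (moveTo q y x) (moveTo t y x) z : ℚ) * G.qdist a z =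
        (weight k (moveTo q x y) (moveTo t x y) z : ℚ) * G.qdist a z
        + (Pi.single y (q x + t x + q y + t y : ℚ) : V → ℚ) z * G.qdist a z
        - (Pi.single x (q x + t x + q y + t y : ℚ) : V → ℚ) z * G.qdist a z := by
        intro z
        by_cases hz : z = x
        · subst hz; simp [weight, hxy, moveTo_right _ hxy.symm]; ring
        · by_cases hz' : z = y
          · subst hz'; simp [weight, hz, moveTo_right _ hxy]; ring
          · simp [weight, hz, hz', moveTo_of_ne]
      simp only [this, Finset.sum_add_distrib, Finset.sum_sub_distrib, sum_single_mul]
    rw [e, e, qdist_self, qdist_self]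
    have hc := G.qdist_comm x y
    rw [not_le] at hA
    rw [hc]
    linarith

/-! ### Nonseparable graphs seen from a heavy vertex -/

namespace IsNonseparable

variable {G : SimpleGraph V}

lemma loadedSum_le_cycle (h : G.IsNonseparable) (u : V) (k : ℕ) {q t : V → ℕ}
    (hq : ∀ z, q z = 0) (ht : ∀ z, t z = 0) {T : ℕ} (hT : T + 2 = Fintype.card V) :
    G.loadedSum (Pi.single u k) q t ≤ lolVal (k + Fintype.card V : ℕ) 1 T := by
  have hw : ∀ z, (weight (Pi.single u k) q t z : ℚ) = 1 + (Pi.single u (k : ℚ) : V → ℚ) z := by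
    intro z
    by_cases hz : z = u
    · subst hz; simp [weight, hq, ht]
    · simp [weight, hq, ht, hz]
  unfold loadedSum
  rw [funext hw, quadSum_add_single (qdist_comm _) (qdist_self _ _)]
  simp only [hq, ht, lolVal_zero, Finset.sum_const_zero, add_zero, one_mul]
  have h1 := h.quadSum_one_le
  have h2 := mul_le_mul_of_nonneg_left (h.sum_qdist_le u) (show (0 : ℚ) ≤ 2 * k by positivity)
  rw [lolVal, lolInner_one, lolTrans_one, hT]
  rw [← hT] at h1 h2 ⊢
  push_cast at h1 h2 ⊢
  linarith

lemma loadedSum_le_lollipop (h : G.IsNonseparable) (u x : V) {k : ℕ} {q t : V → ℕ}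
    (hq : ∀ z, z ≠ x → q z = 0) (ht : ∀ z, z ≠ x → t z = 0) (hqx : 0 < q x) (hk : t x ≤ k)
    {T : ℕ} (hT : T + 2 = t x + Fintype.card V) :
    G.loadedSum (Pi.single u k) q t ≤
      lolVal (k + (Fintype.card V + q x + t x) : ℕ) (q x + 1) T := by
  set b := Fintype.card V
  have hb : 2 ≤ b := h.two_le_card
  have hw : ∀ z, (weight (Pi.single u k) q t z : ℚ) = (1 + (Pi.single u (k : ℚ) : V → ℚ) z)
      + (Pi.single x (q x + t x : ℚ) : V → ℚ) z := by
    intro z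
    by_cases hz : z = u <;> by_cases hz' : z = x
    · subst hz; subst hz'; simp [weight]; ring
    · subst hz; simp [weight, hq _ hz', ht _ hz', hz']
    · subst hz'; simp [weight, hz]; ring
    · simp [weight, hq _ hz', ht _ hz', hz', hz]
  have hN : ∑ z, weight (Pi.single u k) q t z = k + (b + q x + t x) := by
    rw [sum_weight, sum_size, Finset.sum_pi_single', Finset.sum_eq_single x
      (fun z _ hz => hq z hz) (by simp), Finset.sum_eq_single x (fun z _ hz => ht z hz) (by simp)]
    simp [b]
  unfold loadedSum
  rw [funext hw, quadSum_add_single (qdist_comm _) (qdist_self _ _),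
    quadSum_add_single (qdist_comm _) (qdist_self _ _), hN]
  rw [Finset.sum_eq_single (f := fun z => lolVal _ (q z) (t z)) x
    (fun z _ hz => by rw [hq z hz, ht z hz, lolVal_zero]) (by simp)]
  have e : ∑ z, (1 + (Pi.single u (k : ℚ) : V → ℚ) z) * G.qdist x z =
      ∑ z, G.qdist x z + k * G.qdist x u := by
    simp only [add_mul, one_mul, Finset.sum_add_distrib, sum_single_mul]
  rw [e]
  simp only [one_mul]
  have h1 := h.quadSum_one_le
  have h2 := mul_le_mul_of_nonneg_left (h.sum_qdist_le u) (show (0 : ℚ) ≤ 2 * k by positivity)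
  have h3 := mul_le_mul_of_nonneg_left (h.sum_qdist_le x)
    (show (0 : ℚ) ≤ 2 * (q x + t x) by positivity)
  have h4 : G.qdist x u ≤ (b / 2 : ℕ) := by
    unfold qdist; exact_mod_cast h.dist_le_half x u
  have h5 := mul_le_mul_of_nonneg_left h4 (show (0 : ℚ) ≤ 2 * (q x + t x) * k by positivity)
  have h6 := cycle_lollipop_le hb hqx hk
  obtain rfl : T = t x + (b - 2) := by omega
  have hb' : ((b - 2 : ℕ) : ℚ) = b - 2 := by push_cast [hb]; ring
  simp only [lolVal]
  push_cast [hb'] at h1 h2 h3 h4 h5 h6 ⊢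
  linarith

/-- Induction on the number `m` of nontrivial lollipops: merge while there are two, then compare
with a cycle or with a cycle carrying one lollipop. -/
lemma loadedSum_le_root (h : G.IsNonseparable) (u : V) (k : ℕ) (m : ℕ) : ∀ q t : V → ℕ,
    (Finset.univ.filter fun z => 0 < q z).card = m → (∀ z, q z = 0 → t z = 0) →
    ∑ z, (1 + q z + t z) ≤ k + 1 → ∀ T, (∑ z, q z + 1) + T + 1 = ∑ z, (1 + q z + t z) →
    G.loadedSum (Pi.single u k) q t ≤
      lolVal (k + ∑ z, (1 + q z + t z) : ℕ) (∑ z, q z + 1) T := by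
  induction m using Nat.strong_induction_on with
  | _ m ih =>
  intro q t hm hq hk T hT
  have hb := h.two_le_card
  have hs := sum_size q t
  rcases Nat.lt_or_ge m 2 with hm2 | hm2
  · rcases Nat.eq_zero_or_pos m with h0 | h0
    · have hq0 : ∀ z, q z = 0 := by
        rw [h0, Finset.card_eq_zero, Finset.filter_eq_empty_iff] at hm
        intro z
        have := hm (Finset.mem_univ z)
        omega
      have ht0 : ∀ z, t z = 0 := fun z => hq z (hq0 z)
      simp only [hq0, ht0, Finset.sum_const_zero, zero_add, add_zero] at hT hk hs ⊢
      rw [hs]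
      exact h.loadedSum_le_cycle u k hq0 ht0 (by omega)
    · obtain ⟨x, hx⟩ := Finset.card_eq_one.mp (hm.trans (show m = 1 by omega))
      have hqx : 0 < q x := by
        have : x ∈ (Finset.univ.filter fun z => 0 < q z) := by rw [hx]; simp
        simpa using this
      have hqz : ∀ z, z ≠ x → q z = 0 := by
        intro z hz
        by_contra hne
        have : z ∈ (Finset.univ.filter fun z => 0 < q z) := by simp; omega
        rw [hx] at this
        exact hz (by simpa using this)
      have htz : ∀ z, z ≠ x → t z = 0 := fun z hz => hq z (hqz z hz)
      have s1 : ∑ z, q z = q x := Finset.sum_eq_single x (fun z _ hz => hqz z hz) (by simp)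
      have s2 : ∑ z, t z = t x := Finset.sum_eq_single x (fun z _ hz => htz z hz) (by simp)
      rw [s1, s2] at hs
      rw [s1] at hT ⊢
      rw [hs] at hT hk ⊢
      exact h.loadedSum_le_lollipop u x hqz htz hqx (by omega) (by omega)
  · obtain ⟨x, hx, y, hy, hxy⟩ := Finset.one_lt_card.mp (hm ▸ hm2)
    simp only [Finset.mem_filter, Finset.mem_univ, true_and] at hx hy
    have hN : Fintype.card V + (q x + q y) + (t x + t y) ≤ ∑ z, (1 + q z + t z) := by
      rw [hs, sum_eq_add_add_compl hxy q, sum_eq_add_add_compl hxy t]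
      omega
    -- The inert weight at `u` nearly doubles the total: twice the total is at least `4 * M - 2`,
    -- where `M` is the load without it, and `M` is at least the order of the graph plus the size of
    -- both lollipops.
    obtain ⟨q', t', h1, h2, h3, h4, h5⟩ := G.exists_merge (k := Pi.single u k) hq hxy hx hy
      (h.dist_le_half x y) (by
        rw [sum_weight, Finset.sum_pi_single']
        simp only [Finset.mem_univ, if_true]
        omega)
    have hs' := sum_size q' t'
    rw [h2, h3, ← hs] at hs'
    have := ih _ (hm ▸ h4) q' t' rfl h1 (by omega) T (by omega)
    rw [h2, hs'] at this
    exact h5.trans this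

end IsNonseparable

end SimpleGraph

-- Induction along cut-vertices and the one-lollipop bound

universe u

namespace SimpleGraph

/-- Induction on connected graphs along their cut-vertices. -/
theorem connected_induction
    {P : ∀ (V : Type u) [Fintype V] [DecidableEq V], SimpleGraph V → Prop}
    (subsingleton : ∀ (V : Type u) [Fintype V] [DecidableEq V] (G : SimpleGraph V) (_ : V),
      Subsingleton V → P V G)
    (nonseparable : ∀ (V : Type u) [Fintype V] [DecidableEq V] (G : SimpleGraph V),
      G.IsNonseparable → P V G)
    (split : ∀ (V : Type u) [Fintype V] [DecidableEq V] (G : SimpleGraph V) (S T : Set V) (v : V)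
      [Fintype S] [Fintype T], G.Connected → G.IsSplit S T v → 2 ≤ Fintype.card S →
      2 ≤ Fintype.card T → P S (G.induce S) → P T (G.induce T) → P V G) :
    ∀ (V : Type u) [Fintype V] [DecidableEq V] (G : SimpleGraph V), G.Connected → P V G := by
  suffices H : ∀ n (V : Type u) [Fintype V] [DecidableEq V] (G : SimpleGraph V),
      Fintype.card V = n → G.Connected → P V G from fun V _ _ G hG => H _ V G rfl hG
  intro n
  induction n using Nat.strong_induction_on with
  | _ n ih =>
  intro V _ _ G hn hG
  rcases subsingleton_or_nontrivial V with hV | hV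
  · exact subsingleton V G hG.nonempty.some hV
  · by_cases hc : ∀ v, ¬ G.IsCutVertex v
    · exact nonseparable V G ⟨hV, hG, hc⟩
    · push Not at hc
      obtain ⟨v, hv⟩ := hc
      obtain ⟨S, T, h, ⟨x, hx⟩, ⟨y, hy⟩⟩ := hv.exists_isSplit
      classical
      have hcard := h.sum_add (fun _ => 1)
      simp only [Finset.sum_const, Finset.card_univ, smul_eq_mul, mul_one] at hcard
      have hS : Fintype.card S < Fintype.card V := Fintype.card_subtype_lt hx
      have hT : Fintype.card T < Fintype.card V := Fintype.card_subtype_lt hy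
      exact split V G S T v hG h (by omega) (by omega)
        (ih _ (hn ▸ hS) S _ rfl (h.connected hG)) (ih _ (hn ▸ hT) T _ rfl (h.symm.connected hG))

/-- Seen from a vertex of large weight, a loaded graph is dominated by a lollipop. -/
def RootBound (V : Type u) [Fintype V] [DecidableEq V] (G : SimpleGraph V) : Prop :=
  G.numBlocks + 1 ≤ Fintype.card V ∧ (2 ≤ Fintype.card V → 1 ≤ G.numBlocks) ∧
  ∀ (u : V) (k : ℕ) (q t : V → ℕ), (∀ z, q z = 0 → t z = 0) →
    ∑ z, (1 + q z + t z) ≤ k + 1 → ∀ Q T, Q = ∑ z, q z + G.numBlocks →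
    Q + T + 1 = ∑ z, (1 + q z + t z) →
    G.loadedSum (Pi.single u k) q t ≤ lolVal (k + ∑ z, (1 + q z + t z) : ℕ) Q T

/-- The bound on the number of blocks makes the subtraction defining `T` exact. The last clause
keeps the new load admissible: without blocks or lollipops the graph is one bare vertex. -/
lemma RootBound.exists_params {V : Type u} [Fintype V] [DecidableEq V] {G : SimpleGraph V}
    (h : RootBound V G) (q t : V → ℕ) (hq : ∀ z, q z = 0 → t z = 0) :
    ∃ Q T, Q = ∑ z, q z + G.numBlocks ∧ Q + T + 1 = ∑ z, (1 + q z + t z) ∧ (Q = 0 → T = 0) := by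
  have h1 := h.1
  have hs := sum_size q t
  refine ⟨_, ∑ z, (1 + q z + t z) - 1 - (∑ z, q z + G.numBlocks), rfl, by omega, fun h0 => ?_⟩
  have hb : Fintype.card V = 1 := by
    by_contra hne
    have := h.2.1 (by omega)
    omega
  have hq0 : ∀ z, q z = 0 := fun z =>
    (Finset.sum_eq_zero_iff.mp (Nat.eq_zero_of_add_eq_zero_right h0)) z (Finset.mem_univ z)
  have ht0 : ∑ z, t z = 0 := Finset.sum_eq_zero fun z _ => hq z (hq0 z)
  omega

namespace IsSplit

variable {V : Type u} {G : SimpleGraph V} {S T : Set V} {v : V}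

/-- A side of small weight of a split can be replaced by a lollipop. -/
lemma exists_replace [Fintype V] [DecidableEq V] [Fintype S] [Fintype T] (h : G.IsSplit S T v)
    (hG : G.Connected) (hR : RootBound T (G.induce T)) {k q t : V → ℕ}
    (hq : ∀ z, q z = 0 → t z = 0) (hk : ∀ x ∈ T, x ≠ v → k x = 0)
    (hT : 2 * ∑ x : T, (1 + q x + t x) ≤ ∑ x, weight k q t x + 1) :
    ∃ q' t' : S → ℕ, (∀ z, q' z = 0 → t' z = 0) ∧
      ∑ z, (1 + q' z + t' z) = ∑ z, (1 + q z + t z) ∧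
      ∑ z, q' z + (G.induce S).numBlocks = ∑ z, q z + G.numBlocks ∧
      G.loadedSum k q t ≤ (G.induce S).loadedSum (fun x => k x) q' t' := by
  obtain ⟨Q, P, hQ, hP, h0⟩ := hR.exists_params (fun x : T => q x) (fun x => t x)
    fun z => hq z
  -- The inert weight is everything outside `T`, together with `k v`; the lightness of `T` is
  -- exactly what the root bound requires of it.
  have hle := hR.2.2 ⟨v, h.mem_right⟩ (∑ x, weight k q t x - (Q + P + 1)) (fun x : T => q x)
    (fun x => t x) (fun z => hq z) (by omega) Q P hQ hP
  have heq := h.loadedSum_eq hG hk (K := ∑ x, weight k q t x - (Q + P + 1)) (H := Q + P) hP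
    (by omega)
  set vS : S := ⟨v, h.mem_left⟩
  set q' : S → ℕ := Function.update (fun x => q x) vS Q with hq'
  set t' : S → ℕ := Function.update (fun x => t x) vS P with ht'
  have e1 : ∑ z, q' z + ∑ x : T, q x = ∑ z, q z + Q := by
    have := h.sum_add q
    rw [← Finset.add_sum_erase _ _ (Finset.mem_univ vS)]
    rw [← Finset.add_sum_erase _ (fun x : S => q x) (Finset.mem_univ vS)] at this
    have e : ∑ z ∈ Finset.univ.erase vS, q' z = ∑ z ∈ Finset.univ.erase vS, q z :=
      Finset.sum_congr rfl fun z hz => by simp [q', Finset.ne_of_mem_erase hz]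
    have e' : q' vS = Q := by simp [q']
    have e'' : q vS = q v := rfl
    omega
  have e2 : ∑ z, t' z + ∑ x : T, t x = ∑ z, t z + P := by
    have := h.sum_add t
    rw [← Finset.add_sum_erase _ _ (Finset.mem_univ vS)]
    rw [← Finset.add_sum_erase _ (fun x : S => t x) (Finset.mem_univ vS)] at this
    have e : ∑ z ∈ Finset.univ.erase vS, t' z = ∑ z ∈ Finset.univ.erase vS, t z :=
      Finset.sum_congr rfl fun z hz => by simp [t', Finset.ne_of_mem_erase hz]
    have e' : t' vS = P := by simp [t']
    have e'' : t vS = t v := rfl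
    omega
  have hcard := h.sum_add (fun _ => 1)
  simp only [Finset.sum_const, Finset.card_univ, smul_eq_mul, mul_one] at hcard
  have hsize : ∑ z, (1 + q' z + t' z) = ∑ z, (1 + q z + t z) := by
    have s1 := sum_size q t
    have s2 := sum_size q' t'
    have s3 := sum_size (fun x : T => q x) (fun x => t x)
    omega
  refine ⟨q', t', ?_, hsize, ?_, ?_⟩
  · intro z
    by_cases hz : z = vS
    · subst hz; simpa [q', t'] using h0
    · simpa [q', t', hz] using hq z
  · have := h.numBlocks_eq
    omega
  -- Absorbing the new lollipop at `v` gives the same loaded graph on `S` as the splitting formula,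
  -- so only the term of `T` is compared with `lolVal`.
  · have habs := loadedSum_absorb (G.induce S) (fun x => k x) q' t' vS
    have u1 : Function.update q' vS 0 = Function.update (fun x : S => q x) vS 0 := by
      simp [q']
    have u2 : Function.update t' vS 0 = Function.update (fun x : S => t x) vS 0 := by
      simp [t']
    have u3 : q' vS = Q := by simp [q']
    have u4 : t' vS = P := by simp [t']
    have hk' := h.sum_add k
    have hkT : ∑ x : T, k x = k v :=
      Finset.sum_eq_single (⟨v, h.mem_right⟩ : T)
        (fun z _ hz => hk z z.2 fun e => hz (Subtype.ext e)) (by simp)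
    have hN : ∑ y, weight (fun x : S => k x) q' t' y = ∑ x, weight k q t x := by
      rw [sum_weight, sum_weight, hsize]
      omega
    rw [u1, u2, u3, u4, hN] at habs
    have hN2 : ∑ x, weight k q t x - (Q + P + 1) + ∑ z : T, (1 + q z + t z) =
        ∑ x, weight k q t x := by omega
    rw [hN2] at hle
    rw [heq, habs]
    linarith

end IsSplit

lemma loadedSum_of_subsingleton {V : Type u} [Fintype V] [DecidableEq V] (G : SimpleGraph V)
    [Subsingleton V] (k q t : V → ℕ) (u : V) :
    G.loadedSum k q t = lolVal (weight k q t u : ℕ) (q u) (t u) := by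
  have : Unique V := ⟨⟨u⟩, fun a => Subsingleton.elim _ _⟩
  have hu : (default : V) = u := Subsingleton.elim _ _
  simp [loadedSum, quadSum, hu]

/-- At a split, the side away from the heavy vertex `u` is light because the whole load is at most
`k + 1`. It becomes a lollipop at `v`, and the induction hypothesis for the side of `u` finishes. -/
theorem rootBound (V : Type u) [Fintype V] [DecidableEq V] (G : SimpleGraph V)
    (hG : G.Connected) : RootBound V G := by
  refine connected_induction (P := RootBound) ?_ ?_ ?_ V G hG
  · intro V _ _ G u hV
    have hcard : Fintype.card V = 1 := Fintype.card_eq_one_iff.mpr ⟨u, fun y => Subsingleton.elim _ _⟩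
    refine ⟨by rw [numBlocks_of_subsingleton, hcard], by omega, ?_⟩
    intro u k q t hq hk Q T hQ hT
    have hs : ∀ f : V → ℕ, ∑ z, f z = f u := fun f =>
      Finset.sum_eq_single u (fun b _ hb => absurd (Subsingleton.elim _ _) hb) (by simp)
    rw [numBlocks_of_subsingleton, hs] at hQ
    rw [hs] at hT ⊢
    obtain rfl : Q = q u := by omega
    obtain rfl : T = t u := by omega
    rw [loadedSum_of_subsingleton G _ q t u]
    simp [weight]
    apply le_of_eq
    congr 1
    ring
  · intro V _ _ G h
    have := h.two_le_card
    refine ⟨by rw [h.numBlocks]; omega, by rw [h.numBlocks]; omega, ?_⟩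
    intro u k q t hq hk Q T hQ hT
    rw [h.numBlocks] at hQ
    subst hQ
    exact h.loadedSum_le_root u k _ q t rfl hq hk T hT
  · intro V _ _ G S T v _ _ hG h hS hT ihS ihT
    have hb := h.numBlocks_eq
    have hcard := h.sum_add (fun _ => 1)
    simp only [Finset.sum_const, Finset.card_univ, smul_eq_mul, mul_one] at hcard
    have h1 := ihS.1
    have h2 := ihT.1
    have h3 := ihS.2.1 hS
    refine ⟨by omega, by omega, ?_⟩
    intro u k q t hq hk Q P hQ hP
    have key : ∀ (S T : Set V) [Fintype S] [Fintype T], G.IsSplit S T v →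
        RootBound S (G.induce S) → RootBound T (G.induce T) → u ∈ S →
        G.loadedSum (Pi.single u k) q t ≤ lolVal (k + ∑ z, (1 + q z + t z) : ℕ) Q P := by
      intro S T _ _ h ihS ihT hu
      have hN : ∑ x, weight (Pi.single u k) q t x = k + ∑ z, (1 + q z + t z) := by
        rw [sum_weight]; simp
      have hT := h.sum_add (fun z => 1 + q z + t z)
      have hv : 1 + q v + t v ≤ ∑ z : S, (1 + q z + t z) :=
        Finset.single_le_sum (f := fun z : S => 1 + q z + t z) (fun _ _ => Nat.zero_le _)
          (Finset.mem_univ (⟨v, h.mem_left⟩ : S))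
      obtain ⟨q', t', g1, g2, g3, g4⟩ := h.exists_replace hG ihT (k := Pi.single u k) hq
        (by
          intro x hx hxv
          have : x ≠ u := by
            rintro rfl
            exact hxv (h.inter x hu hx)
          simp [this])
        (by omega)
      have hs : (fun x : S => (Pi.single u k : V → ℕ) x) = Pi.single ⟨u, hu⟩ k := by
        funext x
        by_cases hx : x = ⟨u, hu⟩
        · subst hx; simp
        · have : (x : V) ≠ u := fun e => hx (Subtype.ext e)
          simp [hx, this]
      rw [hs] at g4
      rw [← g2]
      exact g4.trans (ihS.2.2 ⟨u, hu⟩ k q' t' g1 (by omega) Q P (by omega) (by omega))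
    rcases h.cover u with hu | hu
    · exact key S T h ihS ihT hu
    · exact key T S h.symm ihT ihS hu

end SimpleGraph

/-! ### The two-lollipop bound -/

/-- The two lightest of three have at most two thirds of the total size, which is the condition of
`lolVal_merge` at root distance 0. -/
lemma exists_two_of_three {q₁ t₁ q₂ t₂ q₃ t₃ N : ℕ} (h₁ : 0 < q₁) (h₂ : 0 < q₂) (h₃ : 0 < q₃)
    (hN : q₁ + t₁ + (q₂ + t₂) + (q₃ + t₃) + 1 = N) :
    ∃ p₁ s₁ p₂ s₂ : ℕ, 0 < p₁ ∧ 0 < p₂ ∧ p₁ + p₂ = q₁ + q₂ + q₃ ∧ p₁ + s₁ + p₂ + s₂ + 1 = N ∧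
      lolVal N q₁ t₁ + lolVal N q₂ t₂ + lolVal N q₃ t₃ ≤ lolVal N p₁ s₁ + lolVal N p₂ s₂ := by
  have key : ∀ a b c d : ℕ, 0 < a → 0 < c → 3 * (a + b + (c + d)) ≤ 2 * N →
      lolVal N a b + lolVal N c d ≤ lolVal N (a + c) (b + d) := by
    intro a b c d ha hc h
    have := lolVal_merge (t₁ := b) (t₂ := d) ha hc (N := N) (d := 0) le_rfl
      (by have : (3 * (a + b + (c + d)) : ℚ) ≤ 2 * N := by exact_mod_cast h
          linarith)
    linarith
  rcases le_total (q₁ + t₁) (q₂ + t₂) with h12 | h12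
  · rcases le_total (q₂ + t₂) (q₃ + t₃) with h23 | h23
    · have := key q₁ t₁ q₂ t₂ h₁ h₂ (by omega)
      exact ⟨q₁ + q₂, t₁ + t₂, q₃, t₃, by omega, h₃, by omega, by omega, by linarith⟩
    · have := key q₁ t₁ q₃ t₃ h₁ h₃ (by omega)
      exact ⟨q₁ + q₃, t₁ + t₃, q₂, t₂, by omega, h₂, by omega, by omega, by linarith⟩
  · rcases le_total (q₁ + t₁) (q₃ + t₃) with h13 | h13
    · have := key q₁ t₁ q₂ t₂ h₁ h₂ (by omega)
      exact ⟨q₁ + q₂, t₁ + t₂, q₃, t₃, by omega, h₃, by omega, by omega, by linarith⟩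
    · have := key q₂ t₂ q₃ t₃ h₂ h₃ (by omega)
      exact ⟨q₂ + q₃, t₂ + t₃, q₁, t₁, by omega, h₁, by omega, by omega, by linarith⟩

namespace SimpleGraph

/-- A loaded graph is dominated by two lollipops sharing their roots. -/
def TwoLollipopBound (V : Type u) [Fintype V] [DecidableEq V] (G : SimpleGraph V) : Prop :=
  ∀ q t : V → ℕ, (∀ z, q z = 0 → t z = 0) → 2 ≤ ∑ z, q z + G.numBlocks →
    ∃ q₁ t₁ q₂ t₂ : ℕ, 0 < q₁ ∧ 0 < q₂ ∧ q₁ + q₂ = ∑ z, q z + G.numBlocks ∧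
      q₁ + t₁ + q₂ + t₂ + 1 = ∑ z, (1 + q z + t z) ∧
      G.loadedSum (fun _ => 0) q t ≤ lolVal (∑ z, (1 + q z + t z) : ℕ) q₁ t₁
        + lolVal (∑ z, (1 + q z + t z) : ℕ) q₂ t₂

variable {V : Type u} [Fintype V] [DecidableEq V] {G : SimpleGraph V}

/-- Absorbing a lollipop of a graph without inert units. -/
lemma loadedSum_zero_absorb (G : SimpleGraph V) (q t : V → ℕ) (x : V) :
    G.loadedSum (fun _ => 0) q t =
      G.loadedSum (Pi.single x (q x + t x)) (Function.update q x 0) (Function.update t x 0)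
      + lolVal (∑ z, (1 + q z + t z) : ℕ) (q x) (t x) := by
  rw [loadedSum_absorb G _ q t x, sum_weight]
  simp only [Finset.sum_const_zero, zero_add]

/-- The only lollipop is one of the two; the block, replaced by a cycle through `x`, is the other.
-/
lemma IsNonseparable.exists_of_eq_zero (h : G.IsNonseparable) {q t : V → ℕ} {x : V}
    (hx : 0 < q x) (hqz : ∀ z, z ≠ x → q z = 0) (htz : ∀ z, z ≠ x → t z = 0) :
    ∃ q₁ t₁ q₂ t₂ : ℕ, 0 < q₁ ∧ 0 < q₂ ∧ q₁ + q₂ = ∑ z, q z + G.numBlocks ∧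
      q₁ + t₁ + q₂ + t₂ + 1 = ∑ z, (1 + q z + t z) ∧
      G.loadedSum (fun _ => 0) q t ≤ lolVal (∑ z, (1 + q z + t z) : ℕ) q₁ t₁
        + lolVal (∑ z, (1 + q z + t z) : ℕ) q₂ t₂ := by
  have hb := h.two_le_card
  have hs := sum_size q t
  have s1 : ∑ z, q z = q x := Finset.sum_eq_single x (fun z _ hz => hqz z hz) (by simp)
  have s2 : ∑ z, t z = t x := Finset.sum_eq_single x (fun z _ hz => htz z hz) (by simp)
  rw [h.numBlocks]
  refine ⟨1, Fintype.card V - 2, q x, t x, one_pos, hx, by omega, by omega, ?_⟩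
  rw [loadedSum_zero_absorb G q t x]
  have hz : ∀ (f : V → ℕ), (∀ z, z ≠ x → f z = 0) → ∀ z, Function.update f x 0 z = 0 := by
    intro f hf z
    by_cases hz : z = x
    · subst hz; simp
    · simpa [hz] using hf z hz
  have := h.loadedSum_le_cycle x (q x + t x) (hz q hqz) (hz t htz)
    (T := Fintype.card V - 2) (by omega)
  rw [show q x + t x + Fintype.card V = ∑ z, (1 + q z + t z) by omega] at this
  linarith

/-- The lollipop at `x` is kept and acts as inert weight; from there, the block with the lollipop at
`y` straightens into a single lollipop. The hypothesis on `t y` holds for at least one order of the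
two vertices. -/
lemma IsNonseparable.exists_of_pair (h : G.IsNonseparable) {q t : V → ℕ} {x y : V} (hxy : x ≠ y)
    (hx : 0 < q x) (hy : 0 < q y) (hk : t y ≤ q x + t x)
    (hqz : ∀ z, z ≠ x → z ≠ y → q z = 0) (htz : ∀ z, z ≠ x → z ≠ y → t z = 0) :
    ∃ q₁ t₁ q₂ t₂ : ℕ, 0 < q₁ ∧ 0 < q₂ ∧ q₁ + q₂ = ∑ z, q z + G.numBlocks ∧
      q₁ + t₁ + q₂ + t₂ + 1 = ∑ z, (1 + q z + t z) ∧
      G.loadedSum (fun _ => 0) q t ≤ lolVal (∑ z, (1 + q z + t z) : ℕ) q₁ t₁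
        + lolVal (∑ z, (1 + q z + t z) : ℕ) q₂ t₂ := by
  have hb := h.two_le_card
  have hs := sum_size q t
  have e : ∀ f : V → ℕ, (∀ z, z ≠ x → z ≠ y → f z = 0) → ∑ z, f z = f x + f y := by
    intro f hf
    rw [sum_eq_add_add_compl hxy, Finset.sum_eq_zero, add_zero]
    intro z hz
    simp only [Finset.mem_erase, Finset.mem_univ, and_true] at hz
    exact hf z hz.2 hz.1
  have s1 := e q hqz
  have s2 := e t htz
  rw [h.numBlocks]
  refine ⟨q y + 1, t y + (Fintype.card V - 2), q x, t x, by omega, hx, by omega, by omega, ?_⟩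
  rw [loadedSum_zero_absorb G q t x]
  have hz : ∀ (f : V → ℕ), (∀ z, z ≠ x → z ≠ y → f z = 0) → ∀ z, z ≠ y →
      Function.update f x 0 z = 0 := by
    intro f hf z hzy
    by_cases hz : z = x
    · subst hz; simp
    · simpa [hz] using hf z hz hzy
  have hqy : Function.update q x 0 y = q y := by simp [hxy.symm]
  have hty : Function.update t x 0 y = t y := by simp [hxy.symm]
  have := h.loadedSum_le_lollipop x y (k := q x + t x) (hz q hqz) (hz t htz)
    (by rwa [hqy]) (by rwa [hty]) (T := t y + (Fintype.card V - 2)) (by rw [hty]; omega)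
  rw [hqy, hty, show q x + t x + (Fintype.card V + q y + t y) = ∑ z, (1 + q z + t z) by omega]
    at this
  linarith

/-- As long as three vertices carry lollipops, the two lighter of some three can be merged; what
remains is one or two lollipops. -/
lemma IsNonseparable.twoLollipopBound (h : G.IsNonseparable) : TwoLollipopBound V G := by
  intro q t
  generalize hm : (Finset.univ.filter fun z => 0 < q z).card = m
  induction m using Nat.strong_induction_on generalizing q t with
  | _ m ih =>
  intro hq hP
  have hb := h.two_le_card
  have hs := sum_size q t
  have hnb := h.numBlocks
  have hmem : ∀ z, z ∈ (Finset.univ.filter fun z => 0 < q z) ↔ 0 < q z := by simp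
  have hnot : ∀ s : Finset V, (Finset.univ.filter fun z => 0 < q z) = s → ∀ z, z ∉ s →
      q z = 0 := by
    rintro _ rfl z hz
    rw [hmem] at hz
    omega
  rcases Nat.lt_or_ge 2 m with hm2 | hm2
  · have key : ∀ x y w : V, x ≠ y → x ≠ w → y ≠ w → 0 < q x → 0 < q y →
        q x + t x ≤ q w + t w → q y + t y ≤ q w + t w →
        ∃ q₁ t₁ q₂ t₂ : ℕ, 0 < q₁ ∧ 0 < q₂ ∧ q₁ + q₂ = ∑ z, q z + G.numBlocks ∧
        q₁ + t₁ + q₂ + t₂ + 1 = ∑ z, (1 + q z + t z) ∧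
        G.loadedSum (fun _ => 0) q t ≤ lolVal (∑ z, (1 + q z + t z) : ℕ) q₁ t₁
          + lolVal (∑ z, (1 + q z + t z) : ℕ) q₂ t₂ := by
      intro x y w hxy hxw hyw hx hy h1 h2
      have hN : ∀ f : V → ℕ, f x + f y + f w ≤ ∑ z, f z := by
        intro f
        have hw : w ∈ (Finset.univ.erase x).erase y := by simp [hxw.symm, hyw.symm]
        rw [sum_eq_add_add_compl hxy f, ← Finset.add_sum_erase _ f hw]
        omega
      have hN1 := hN q
      have hN2 := hN t
      -- Four times half the order is at most twice the order, and three times the two lighter sizes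
      -- is at most twice the sum of the three.
      obtain ⟨q', t', g1, g2, g3, g4, g5⟩ := G.exists_merge (k := fun _ => 0) hq hxy hx hy
        (h.dist_le_half x y) (by
          rw [sum_weight, Finset.sum_const_zero]
          omega)
      have hs' := sum_size q' t'
      rw [g2, g3, ← hs] at hs'
      obtain ⟨q₁, t₁, q₂, t₂, f1, f2, f3, f4, f5⟩ := ih _ (hm ▸ g4) q' t' rfl g1 (by omega)
      rw [hs'] at f4 f5
      exact ⟨q₁, t₁, q₂, t₂, f1, f2, by omega, f4, g5.trans f5⟩
    obtain ⟨x, y, w, hx, hy, hw, hxy, hxw, hyw⟩ := Finset.two_lt_card_iff.mp (hm ▸ hm2)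
    rw [hmem] at hx hy hw
    rcases le_total (q x + t x) (q y + t y) with h12 | h12
    · rcases le_total (q y + t y) (q w + t w) with h23 | h23
      · exact key x y w hxy hxw hyw hx hy (by omega) (by omega)
      · exact key x w y hxw hxy hyw.symm hx hw (by omega) (by omega)
    · rcases le_total (q x + t x) (q w + t w) with h23 | h23
      · exact key x y w hxy hxw hyw hx hy (by omega) (by omega)
      · exact key y w x hyw hxy.symm hxw.symm hy hw (by omega) (by omega)
  · interval_cases m
    · have hq0 := hnot _ (Finset.card_eq_zero.mp hm)
      simp only [Finset.notMem_empty, not_false_eq_true, forall_const] at hq0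
      simp [hq0, hnb] at hP
    · obtain ⟨x, hx⟩ := Finset.card_eq_one.mp hm
      have hqx : 0 < q x := by rw [← hmem, hx]; simp
      have hq0 : ∀ z, z ≠ x → q z = 0 := fun z hz => hnot _ hx z (by simpa using hz)
      exact h.exists_of_eq_zero hqx hq0 fun z hz => hq z (hq0 z hz)
    · obtain ⟨x, y, hxy, hx⟩ := Finset.card_eq_two.mp hm
      have hqx : 0 < q x := by rw [← hmem, hx]; simp
      have hqy : 0 < q y := by rw [← hmem, hx]; simp
      have hq0 : ∀ z, z ≠ x → z ≠ y → q z = 0 := fun z hz hz' =>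
        hnot _ hx z (by simp [hz, hz'])
      rcases le_or_gt (t y) (q x + t x) with hk | hk
      · exact h.exists_of_pair hxy hqx hqy hk hq0 fun z hz hz' => hq z (hq0 z hz hz')
      · exact h.exists_of_pair hxy.symm hqy hqx (by omega) (fun z hz hz' => hq0 z hz' hz)
          fun z hz hz' => hq z (hq0 z hz' hz)

/-- Three large loads at a cut-vertex: both sides are replaced by lollipops. -/
lemma IsSplit.exists_of_balanced {S T : Set V} {v : V} [Fintype S] [Fintype T]
    (h : G.IsSplit S T v) (hG : G.Connected) (hS : 2 ≤ Fintype.card S) (hT : 2 ≤ Fintype.card T)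
    {q t : V → ℕ} (hq : ∀ z, q z = 0 → t z = 0)
    (h₁ : ∑ z, (1 + q z + t z) + 1 < 2 * ∑ x : S, (1 + q x + t x))
    (h₂ : ∑ z, (1 + q z + t z) + 1 < 2 * ∑ x : T, (1 + q x + t x)) :
    ∃ q₁ t₁ q₂ t₂ : ℕ, 0 < q₁ ∧ 0 < q₂ ∧ q₁ + q₂ = ∑ z, q z + G.numBlocks ∧
      q₁ + t₁ + q₂ + t₂ + 1 = ∑ z, (1 + q z + t z) ∧
      G.loadedSum (fun _ => 0) q t ≤ lolVal (∑ z, (1 + q z + t z) : ℕ) q₁ t₁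
        + lolVal (∑ z, (1 + q z + t z) : ℕ) q₂ t₂ := by
  have rS := rootBound S _ (h.connected hG)
  have rT := rootBound T _ (h.symm.connected hG)
  have hnS := rS.2.1 hS
  have hnT := rT.2.1 hT
  have hsum := h.sum_add (fun z => 1 + q z + t z)
  have hsumq := h.sum_add q
  have hsumt := h.sum_add t
  have hnb := h.numBlocks_eq
  -- With a bare `v` the two sides would have total weight one more than the whole, so they could
  -- not both exceed half of that.
  have hqv : 0 < q v := by
    by_contra h0
    have h0 : q v = 0 := by omega
    have := hq v h0
    omega
  set vS : S := ⟨v, h.mem_left⟩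
  set vT : T := ⟨v, h.mem_right⟩
  have upd : ∀ (W : Set V) [Fintype W] (vW : W) (f : V → ℕ),
      ∑ z, Function.update (fun x : W => f x) vW 0 z + f vW = ∑ z : W, f z := by
    intro W _ vW f
    rw [← Finset.add_sum_erase _ _ (Finset.mem_univ vW),
      ← Finset.add_sum_erase _ (fun x : W => f x) (Finset.mem_univ vW)]
    have e : ∑ z ∈ Finset.univ.erase vW, Function.update (fun x : W => f x) vW 0 z =
        ∑ z ∈ Finset.univ.erase vW, f z :=
      Finset.sum_congr rfl fun z hz => by simp [Finset.ne_of_mem_erase hz]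
    simp only [Function.update_self]
    omega
  have hupd : ∀ (W : Set V) [Fintype W] (vW : W),
      ∀ z, Function.update (fun x : W => q x) vW 0 z = 0 →
        Function.update (fun x : W => t x) vW 0 z = 0 := by
    intro W _ vW z
    by_cases hz : z = vW
    · subst hz; simp
    · simpa [hz] using hq z
  have sS := sum_size (Function.update (fun x : S => q x) vS 0)
    (Function.update (fun x : S => t x) vS 0)
  have sT := sum_size (Function.update (fun x : T => q x) vT 0)
    (Function.update (fun x : T => t x) vT 0)
  have sS' := sum_size (fun x : S => q x) (fun x : S => t x)
  have sT' := sum_size (fun x : T => q x) (fun x : T => t x)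
  have uSq := upd S vS q
  have uSt := upd S vS t
  have uTq := upd T vT q
  have uTt := upd T vT t
  change _ + q v = _ at uSq uTq
  change _ + t v = _ at uSt uTt
  obtain ⟨Q₁, P₁, hQ₁, hP₁, -⟩ := rS.exists_params _ _ (hupd S vS)
  obtain ⟨Q₂, P₂, hQ₂, hP₂, -⟩ := rT.exists_params _ _ (hupd T vT)
  -- The lollipop at `v` is set apart as a third load. Each side without it is light, because the
  -- other side with it is heavy, so `rootBound` applies to both.
  have heq := h.loadedSum_eq hG (k := fun _ => 0) (q := q) (t := t) (fun _ _ _ => rfl)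
    (K := Q₁ + P₁) (H := Q₂ + P₂ + (q v + t v)) (by omega)
    (by rw [sum_weight, Finset.sum_const_zero]; omega)
  have habs := loadedSum_absorb (G.induce T) (Pi.single vT (Q₁ + P₁)) (fun x => q x)
    (fun x => t x) vT
  have hk1 : (fun x : S => 0 + (Pi.single vS (Q₂ + P₂ + (q v + t v)) : S → ℕ) x) =
      Pi.single vS (Q₂ + P₂ + (q v + t v)) := by funext x; simp
  have hk2 : (fun x : T => (Pi.single vT (Q₁ + P₁) : T → ℕ) x
      + (Pi.single vT (q vT + t vT) : T → ℕ) x) = Pi.single vT (Q₁ + P₁ + (q v + t v)) := by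
    funext x
    by_cases hx : x = vT
    · subst hx; simp [vT]
    · simp [hx]
  have hNT : ∑ y, weight (Pi.single vT (Q₁ + P₁)) (fun x : T => q x) (fun x : T => t x) y =
      ∑ z, (1 + q z + t z) := by
    rw [sum_weight, Finset.sum_pi_single']
    simp only [Finset.mem_univ, if_true]
    omega
  rw [hk1] at heq
  rw [hk2, hNT] at habs
  have bS := rS.2.2 vS (Q₂ + P₂ + (q v + t v)) _ _ (hupd S vS) (by omega) Q₁ P₁ hQ₁ hP₁
  have bT := rT.2.2 vT (Q₁ + P₁ + (q v + t v)) _ _ (hupd T vT) (by omega) Q₂ P₂ hQ₂ hP₂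
  rw [← hP₁, show Q₂ + P₂ + (q v + t v) + (Q₁ + P₁ + 1) = ∑ z, (1 + q z + t z) by omega] at bS
  rw [← hP₂, show Q₁ + P₁ + (q v + t v) + (Q₂ + P₂ + 1) = ∑ z, (1 + q z + t z) by omega] at bT
  obtain ⟨p₁, s₁, p₂, s₂, f1, f2, f3, f4, f5⟩ := exists_two_of_three
    (q₁ := Q₁) (t₁ := P₁) (q₂ := Q₂) (t₂ := P₂) (q₃ := q v) (t₃ := t v)
    (N := ∑ z, (1 + q z + t z)) (by omega) (by omega) hqv (by omega)
  refine ⟨p₁, s₁, p₂, s₂, f1, f2, by omega, f4, ?_⟩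
  rw [heq, habs]
  have : lolVal (∑ z, (1 + q z + t z) : ℕ) (q vT) (t vT) =
    lolVal (∑ z, (1 + q z + t z) : ℕ) (q v) (t v) := rfl
  linarith

theorem twoLollipopBound (V : Type u) [Fintype V] [DecidableEq V] (G : SimpleGraph V)
    (hG : G.Connected) : TwoLollipopBound V G := by
  refine connected_induction (P := TwoLollipopBound) ?_ ?_ ?_ V G hG
  · intro V _ _ G u hV q t hq hP
    have hs : ∀ f : V → ℕ, ∑ z, f z = f u := fun f =>
      Finset.sum_eq_single u (fun b _ hb => absurd (Subsingleton.elim _ _) hb) (by simp)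
    rw [numBlocks_of_subsingleton, hs] at *
    obtain ⟨r, hr⟩ := Nat.exists_eq_add_of_le hP
    rw [hs]
    -- A lone lollipop is rerooted at the next vertex of its path: its first edge becomes the second
    -- lollipop.
    refine ⟨1, 0, q u - 1, t u, one_pos, by omega, by omega, by omega, ?_⟩
    rw [loadedSum_of_subsingleton G _ q t u]
    obtain ⟨m, hm⟩ : ∃ m, q u = m + 1 := ⟨q u - 1, by omega⟩
    rw [hm, Nat.add_sub_cancel, ← lolVal_succ _ _ _ (by push_cast; ring)]
    simp [weight, hm]
  · intro V _ _ G h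
    exact h.twoLollipopBound
  · intro V _ _ G S T v _ _ hG h hS hT ihS ihT q t hq hP
    have hN : ∑ x, weight (fun _ => 0) q t x = ∑ z, (1 + q z + t z) := by
      rw [sum_weight]; simp
    have key : ∀ (S T : Set V) [Fintype S] [Fintype T], G.IsSplit S T v →
        RootBound T (G.induce T) → TwoLollipopBound S (G.induce S) →
        2 * ∑ x : T, (1 + q x + t x) ≤ ∑ z, (1 + q z + t z) + 1 →
        ∃ q₁ t₁ q₂ t₂ : ℕ, 0 < q₁ ∧ 0 < q₂ ∧ q₁ + q₂ = ∑ z, q z + G.numBlocks ∧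
        q₁ + t₁ + q₂ + t₂ + 1 = ∑ z, (1 + q z + t z) ∧
        G.loadedSum (fun _ => 0) q t ≤ lolVal (∑ z, (1 + q z + t z) : ℕ) q₁ t₁
          + lolVal (∑ z, (1 + q z + t z) : ℕ) q₂ t₂ := by
      intro S T _ _ h rT bS hle
      obtain ⟨q', t', g1, g2, g3, g4⟩ := h.exists_replace hG rT (k := fun _ => 0) hq
        (fun _ _ _ => rfl) (by omega)
      obtain ⟨q₁, t₁, q₂, t₂, f1, f2, f3, f4, f5⟩ := bS q' t' g1 (by omega)
      rw [g2] at f4 f5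
      exact ⟨q₁, t₁, q₂, t₂, f1, f2, by omega, f4, g4.trans f5⟩
    rcases Nat.lt_or_ge (∑ z, (1 + q z + t z) + 1) (2 * ∑ x : T, (1 + q x + t x)) with h2 | h2
    · rcases Nat.lt_or_ge (∑ z, (1 + q z + t z) + 1) (2 * ∑ x : S, (1 + q x + t x)) with h1 | h1
      · exact h.exists_of_balanced hG hS hT hq h1 h2
      · exact key T S h.symm (rootBound S _ (h.connected hG)) ihT h1
    · exact key S T h (rootBound T _ (h.symm.connected hG)) ihS h2

/-- A connected graph with at least two blocks. -/
theorem exists_sum_dist_le (hG : G.Connected) (hP : 2 ≤ G.numBlocks) :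
    ∃ q₁ t₁ q₂ t₂ : ℕ, 0 < q₁ ∧ 0 < q₂ ∧ q₁ + q₂ = G.numBlocks ∧
      q₁ + t₁ + q₂ + t₂ + 1 = Fintype.card V ∧
      ∑ x, ∑ y, G.qdist x y ≤ lolVal (Fintype.card V) q₁ t₁ + lolVal (Fintype.card V) q₂ t₂ := by
  have := twoLollipopBound V G hG (fun _ => 0) (fun _ => 0) (fun _ _ => rfl) (by simpa using hP)
  simpa [loadedSum, quadSum, weight, lolVal_zero] using this

end SimpleGraph

/-! ### Lollipop graphs with labelled vertices -/

/-- `pos` enumerates its domain by the integers `c, …, c + m - 1`. -/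
structure IsPos {V : Type*} (pos : V → ℕ) (c m : ℕ) : Prop where
  inj : Function.Injective pos
  le : ∀ x, c ≤ pos x
  lt : ∀ x, pos x < c + m
  surj : ∀ i, c ≤ i → i < c + m → ∃ x, pos x = i

namespace IsPos

variable {V : Type*} {pos : V → ℕ} {c m : ℕ}

/-- The enumeration as an equivalence with `Fin m`. -/
noncomputable def equivFin (h : IsPos pos c m) : V ≃ Fin m :=
  Equiv.ofBijective
    (fun x => ⟨pos x - c, by have := h.le x; have := h.lt x; omega⟩) <| by
    constructor
    · intro x y hxy
      have hxy : pos x - c = pos y - c := congrArg Fin.val hxy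
      have := h.le x
      have := h.le y
      exact h.inj (by omega)
    · intro i
      obtain ⟨x, hx⟩ := h.surj (c + i) (by omega) (by omega)
      exact ⟨x, by ext; simp [hx]⟩

lemma equivFin_val (h : IsPos pos c m) (x : V) : (h.equivFin x : ℕ) = pos x - c := rfl

lemma sum_eq [Fintype V] (h : IsPos pos c m) {M : Type*} [AddCommMonoid M] (f : ℕ → M) :
    ∑ x, f (pos x - c) = ∑ i ∈ Finset.range m, f i := by
  rw [← Fin.sum_univ_eq_sum_range, ← h.equivFin.sum_comp]
  rfl

lemma card_eq [Fintype V] (h : IsPos pos c m) : Fintype.card V = m := by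
  have := h.sum_eq (fun _ => 1)
  rw [Finset.sum_const, Finset.sum_const, Finset.card_univ, Finset.card_range] at this
  simpa only [smul_eq_mul, mul_one] using this

lemma restrict (h : IsPos pos c m) {c' m' : ℕ} (S : Set V) (hc : c ≤ c') (hm : c' + m' ≤ c + m)
    (hS : ∀ x, x ∈ S ↔ c' ≤ pos x ∧ pos x < c' + m') :
    IsPos (fun x : S => pos x) c' m' where
  inj := h.inj.comp Subtype.val_injective
  le x := ((hS x).mp x.2).1
  lt x := ((hS x).mp x.2).2
  surj i h1 h2 := by
    obtain ⟨x, hx⟩ := h.surj i (by omega) (by omega)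
    exact ⟨⟨x, (hS x).mpr (by omega)⟩, hx⟩

end IsPos

lemma sum_min_tsub (b : ℕ) : ∑ m ∈ Finset.range b, min m (b - m) = quarterSq b := by
  induction b using Nat.twoStepInduction with
  | zero => simp [quarterSq]
  | one => simp [quarterSq]
  | more n ih _ =>
    rw [Finset.sum_range_succ', Finset.sum_range_succ]
    have : ∀ i ∈ Finset.range n, min (i + 1) (n + 2 - (i + 1)) = min i (n - i) + 1 := by
      intro i hi
      rw [Finset.mem_range] at hi
      omega
    rw [Finset.sum_congr rfl this, Finset.sum_add_distrib, ih]
    obtain ⟨m, rfl | rfl⟩ := parity_cases n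
    · rw [show 2 * m + 2 = 2 * (m + 1) by ring, quarterSq_double, quarterSq_double]
      have : (m + 1) * (m + 1) = m * m + 2 * m + 1 := by ring
      simp
      omega
    · rw [show 2 * m + 1 + 2 = 2 * (m + 1) + 1 by ring, quarterSq_double_add_one,
        quarterSq_double_add_one]
      have : (m + 1) * (m + 1) = m * m + 2 * m + 1 := by ring
      simp
      omega

/-- Distance between `i` and `j` on a cycle of length `b`. -/
def cycDist (b i j : ℕ) : ℕ := min ((i - j) + (j - i)) (b - ((i - j) + (j - i)))

lemma sum_cycDist {b i : ℕ} (hi : i < b) :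
    ∑ j ∈ Finset.range b, cycDist b i j = quarterSq b := by
  rw [← sum_min_tsub]
  obtain ⟨l, rfl⟩ := Nat.exists_eq_add_of_le hi.le
  rw [Finset.sum_range_add, add_comm i l, Finset.sum_range_add, add_comm]
  congr 1
  · refine Finset.sum_congr rfl fun j hj => ?_
    rw [Finset.mem_range] at hj
    unfold cycDist
    omega
  · refine Finset.sum_congr rfl fun j hj => ?_
    rw [Finset.mem_range] at hj
    unfold cycDist
    omega

namespace SimpleGraph

/-- Adjacency on a path with vertices labelled by integers, with the chord `a`, `b` added. -/
def ChordAdj (i j a b : ℕ) : Prop :=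
  i ≠ j ∧ (i + 1 = j ∨ j + 1 = i ∨ (i = a ∧ j = b) ∨ (i = b ∧ j = a))

variable {V : Type*}

/-- `G` is a path with `r` edges starting at position `c`, followed by a cycle on `t + 2`
vertices. -/
structure IsLollipop (G : SimpleGraph V) (pos : V → ℕ) (c r t : ℕ) : Prop where
  isPos : IsPos pos c (r + t + 2)
  adj : ∀ x y, G.Adj x y ↔ ChordAdj (pos x) (pos y) (c + r) (c + r + t + 1)

lemma reachable_of_consecutive {G : SimpleGraph V} {pos : V → ℕ}
    (hinj : Function.Injective pos) (hadj : ∀ a b, pos a + 1 = pos b → G.Adj a b) (d : ℕ) :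
    ∀ x y, pos y = pos x + d → (∀ i, pos x ≤ i → i ≤ pos y → ∃ z, pos z = i) →
      G.Reachable x y := by
  induction d with
  | zero =>
    intro x y h _
    rw [hinj h]
  | succ d ih =>
    intro x y h hz
    obtain ⟨z, hz'⟩ := hz (pos x + d) (by omega) (by omega)
    exact (ih x z hz' fun i h1 h2 => hz i h1 (by omega)).trans (hadj z y (by omega)).reachable

namespace IsLollipop

variable {G : SimpleGraph V} {pos : V → ℕ} {c r t : ℕ}

lemma consecutive (h : G.IsLollipop pos c r t) (a b : V) (hab : pos a + 1 = pos b) :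
    G.Adj a b := (h.adj a b).mpr ⟨by omega, Or.inl hab⟩

lemma connected (h : G.IsLollipop pos c r t) : G.Connected := by
  obtain ⟨z, hz⟩ := h.isPos.surj c le_rfl (by omega)
  have : Nonempty V := ⟨z⟩
  have key : ∀ x, G.Reachable z x := by
    intro x
    have h1 := h.isPos.le x
    have h2 := h.isPos.lt x
    exact reachable_of_consecutive h.isPos.inj h.consecutive (pos x - c) z x (by omega)
      fun i hi hi' => h.isPos.surj i (by omega) (by omega)
  exact ⟨fun x y => (key x).symm.trans (key y)⟩

/-- After deleting `w`, two vertices are joined along the labels if `w` is not between them, and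
otherwise the other way round through the closing chord. -/
lemma isNonseparable (h : G.IsLollipop pos c 0 t) : G.IsNonseparable := by
  obtain ⟨z₀, hz₀⟩ := h.isPos.surj c le_rfl (by omega)
  obtain ⟨z₁, hz₁⟩ := h.isPos.surj (c + t + 1) (by omega) (by omega)
  refine ⟨⟨z₀, z₁, fun e => by rw [e] at hz₀; omega⟩, h.connected, ?_⟩
  have key : ∀ w x y : V, ∀ (hx : x ≠ w) (hy : y ≠ w), pos x ≤ pos y →
      (G.induce {z | z ≠ w}).Reachable ⟨x, hx⟩ ⟨y, hy⟩ := by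
    intro w
    have seg : ∀ x y : V, ∀ (hx : x ≠ w) (hy : y ≠ w), pos x ≤ pos y →
        (pos w < pos x ∨ pos y < pos w) →
        (G.induce {z | z ≠ w}).Reachable ⟨x, hx⟩ ⟨y, hy⟩ := by
      intro x y hx hy hxy hw
      refine reachable_of_consecutive (pos := fun z : {z | z ≠ w} => pos z)
        (h.isPos.inj.comp Subtype.val_injective) (fun a b hab => h.consecutive a b hab)
        (pos y - pos x) _ _ (by simp only; omega) ?_
      intro i h1 h2
      simp only at h1 h2
      have := h.isPos.le x
      have := h.isPos.lt y
      obtain ⟨z, hz⟩ := h.isPos.surj i (by omega) (by omega)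
      exact ⟨⟨z, by rintro rfl; omega⟩, hz⟩
    intro x y hx hy hxy
    have hxw : pos x ≠ pos w := fun e => hx (h.isPos.inj e)
    have hyw : pos y ≠ pos w := fun e => hy (h.isPos.inj e)
    by_cases hw : pos w < pos x ∨ pos y < pos w
    · exact seg x y hx hy hxy hw
    · have h1 := h.isPos.le x
      have h2 := h.isPos.lt y
      have hw₀ : z₀ ≠ w := by rintro rfl; omega
      have hw₁ : z₁ ≠ w := by rintro rfl; omega
      have e1 := seg z₀ x hw₀ hx (by omega) (by omega)
      have e2 := seg y z₁ hy hw₁ (by omega) (by omega)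
      have e3 : (G.induce {z | z ≠ w}).Adj ⟨z₀, hw₀⟩ ⟨z₁, hw₁⟩ := by
        refine (h.adj z₀ z₁).mpr ⟨by omega, ?_⟩
        omega
      exact e1.symm.trans (e3.reachable.trans e2.symm)
  rintro w ⟨x, y, hx, hy, -, hxy⟩
  rcases le_total (pos x) (pos y) with hle | hle
  · exact hxy (key w x y hx hy hle)
  · exact hxy (key w y x hy hx hle).symm

/-- An edge changes the cyclic distance to a fixed label by at most one. -/
lemma cycDist_le_dist (h : G.IsLollipop pos c 0 t) (x y : V) :
    cycDist (t + 2) (pos x - c) (pos y - c) ≤ G.dist x y := by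
  obtain ⟨p, hp⟩ := (h.connected.preconnected x y).exists_walk_length_eq_dist
  rw [← hp]
  clear hp
  induction p with
  | nil => simp [cycDist]
  | cons hadj p ih =>
    rename_i x z y
    rw [Walk.length_cons]
    refine le_trans ?_ (Nat.add_le_add_right ih 1)
    have hx := h.isPos.le x
    have hx' := h.isPos.lt x
    have hy := h.isPos.le y
    have hy' := h.isPos.lt y
    have hz := h.isPos.le z
    have hz' := h.isPos.lt z
    have := (h.adj x z).mp hadj
    unfold ChordAdj at this
    unfold cycDist
    omega

lemma le_sum_dist (h : G.IsLollipop pos c 0 t) [Fintype V] (x : V) :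
    (quarterSq (t + 2) : ℚ) ≤ ∑ y, G.qdist x y := by
  have hx := h.isPos.le x
  have hx' := h.isPos.lt x
  have h1 := h.isPos.sum_eq (fun j => cycDist (t + 2) (pos x - c) j)
  rw [show 0 + t + 2 = t + 2 by ring, sum_cycDist (by omega)] at h1
  have h2 := Finset.sum_le_sum fun y (_ : y ∈ Finset.univ) => h.cycDist_le_dist x y
  rw [h1] at h2
  unfold qdist
  exact_mod_cast h2

lemma isSplit (h : G.IsLollipop pos c (r + 1) t) {v : V} (hv : pos v = c + 1) :
    G.IsSplit {x | pos x ≤ c + 1} {x | c + 1 ≤ pos x} v where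
  mem_left := hv.le
  mem_right := hv.ge
  cover x := le_total (pos x) (c + 1)
  inter x hx hx' := h.isPos.inj (by rw [hv]; exact le_antisymm hx hx')
  adj x y hxy := by
    have hx := h.isPos.le x
    have hy := h.isPos.le y
    have := (h.adj x y).mp hxy
    unfold ChordAdj at this
    simp only [Set.mem_ofPred_eq]
    omega

lemma left (h : G.IsLollipop pos c (r + 1) t) :
    (G.induce {x | pos x ≤ c + 1}).IsLollipop (fun x => pos x) c 0 0 where
  isPos := h.isPos.restrict _ le_rfl (by omega) fun x => by
    have := h.isPos.le x
    simp only [Set.mem_ofPred_eq]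
    omega
  adj x y := by
    have hx : pos x ≤ c + 1 := x.2
    have hy : pos y ≤ c + 1 := y.2
    have hx' := h.isPos.le x
    have hy' := h.isPos.le y
    rw [induce_adj, h.adj]
    unfold ChordAdj
    omega

lemma right (h : G.IsLollipop pos c (r + 1) t) :
    (G.induce {x | c + 1 ≤ pos x}).IsLollipop (fun x => pos x) (c + 1) r t where
  isPos := h.isPos.restrict _ (by omega) (by omega) fun x => by
    have := h.isPos.lt x
    simp only [Set.mem_ofPred_eq]
    omega
  adj x y := by
    have hx : c + 1 ≤ pos x := x.2
    have hy : c + 1 ≤ pos y := y.2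
    rw [induce_adj, h.adj]
    unfold ChordAdj
    omega

end IsLollipop

lemma IsSplit.quadSum_one_eq {G : SimpleGraph V} {S T : Set V} {v : V} [Fintype V] [Fintype S]
    [Fintype T] (h : G.IsSplit S T v) (hG : G.Connected) :
    quadSum G.qdist (fun _ => 1) =
      quadSum (G.induce S).qdist (fun _ => 1)
        + 2 * (Fintype.card T - 1) * ∑ x, (G.induce S).qdist ⟨v, h.mem_left⟩ x
      + (quadSum (G.induce T).qdist (fun _ => 1)
        + 2 * (Fintype.card S - 1) * ∑ x, (G.induce T).qdist ⟨v, h.mem_right⟩ x) := by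
  have := h.quadSum_eq hG (fun _ => 1)
  simp only [qdist, h.dist_left hG, h.symm.dist_left hG]
  simpa [qdist] using this

/-- Induction peels off the first edge of the path, which is itself a lollipop with a 2-cycle. The
inner sum plus twice the root transmission is the sum over all ordered pairs. -/
lemma IsLollipop.bounds (r : ℕ) : ∀ {V : Type} [Fintype V] {G : SimpleGraph V} {pos : V → ℕ}
    {c t : ℕ}, G.IsLollipop pos c r t → G.numBlocks = r + 1 ∧
      (∀ u, pos u = c → lolTrans (r + 1) t ≤ ∑ y, G.qdist u y) ∧
      lolInner (r + 1) t + 2 * lolTrans (r + 1) t ≤ quadSum G.qdist (fun _ => 1) := by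
  induction r with
  | zero =>
    intro V _ G pos c t h
    refine ⟨h.isNonseparable.numBlocks, fun u _ => ?_, ?_⟩
    · rw [zero_add, lolTrans_one]
      exact h.le_sum_dist u
    · have h1 := Finset.sum_le_sum fun x (_ : x ∈ Finset.univ) => h.le_sum_dist x
      rw [Finset.sum_const, Finset.card_univ, h.isPos.card_eq, nsmul_eq_mul] at h1
      rw [zero_add, lolTrans_one, lolInner_one]
      simp only [quadSum, one_mul]
      push_cast at h1
      linarith
  | succ r ih =>
    intro V _ G pos c t h
    classical
    obtain ⟨v, hv⟩ := h.isPos.surj (c + 1) (by omega) (by omega)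
    have hs := h.isSplit hv
    obtain ⟨b1, b2, b3⟩ := ih h.right
    have b2 := b2 ⟨v, hs.mem_right⟩ hv
    have cS := h.left.isPos.card_eq
    have cT := h.right.isPos.card_eq
    have hL := h.left
    have hLs := fun x => hL.le_sum_dist x
    have hone : (quarterSq (0 + 2) : ℚ) = 1 := by simp [quarterSq]
    rw [hone] at hLs
    refine ⟨?_, ?_, ?_⟩
    · rw [hs.numBlocks_eq, hL.isNonseparable.numBlocks, b1]
      ring
    · intro u hu
      have huS : u ∈ {x | pos x ≤ c + 1} := by simp [hu]
      have hrow := hs.quadSum_row h.connected (fun _ => 1) huS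
      have e1 : ∑ y : {x | pos x ≤ c + 1}, G.qdist u y =
          ∑ y, (G.induce {x | pos x ≤ c + 1}).qdist ⟨u, huS⟩ y := by
        simp only [qdist, hs.dist_left h.connected]
      have e2 : ∑ y : {x | c + 1 ≤ pos x}, G.qdist v y =
          ∑ y, (G.induce {x | c + 1 ≤ pos x}).qdist ⟨v, hs.mem_right⟩ y := by
        simp only [qdist, hs.symm.dist_left h.connected]
      have e3 : G.qdist u v = 1 := by
        unfold qdist
        rw [dist_eq_one_iff_adj.mpr (h.consecutive u v (by omega))]
        simp
      simp only [one_mul, Finset.sum_const, Finset.card_univ, cT, nsmul_eq_mul, mul_one] at hrow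
      rw [e1, e2, e3] at hrow
      rw [hrow]
      have := hLs ⟨u, huS⟩
      have : lolTrans (r + 1 + 1) t = lolTrans (r + 1) t + (r + 1 + t + 1) := by
        simp only [lolTrans]; push_cast; ring
      push_cast
      linarith
    · rw [hs.quadSum_one_eq h.connected, cS, cT]
      have h1 := Finset.sum_le_sum fun x (_ : x ∈ Finset.univ) => hLs x
      rw [Finset.sum_const, Finset.card_univ, cS, nsmul_eq_mul] at h1
      have h2 : quadSum (G.induce {x | pos x ≤ c + 1}).qdist (fun _ => 1) =
          ∑ x, ∑ y, (G.induce {x | pos x ≤ c + 1}).qdist x y := by simp [quadSum]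
      have h3 := hLs ⟨v, hs.mem_left⟩
      have h4 := mul_le_mul_of_nonneg_left h3 (show (0 : ℚ) ≤ 2 * (r + t + 1) by positivity)
      have h5 : lolInner (r + 1 + 1) t + 2 * lolTrans (r + 1 + 1) t =
          2 + 2 * (r + t + 1) + (lolInner (r + 1) t + 2 * lolTrans (r + 1) t)
            + 2 * lolTrans (r + 1) t := by
        simp only [lolInner, lolTrans]; push_cast; ring
      push_cast at h1 ⊢
      rw [h2, h5]
      linarith

end SimpleGraph

/-! ### Sliding the common root -/

/-- For `q₁ > 0` both sides evaluate the same graph, since the two lollipops exhaust the weight `N`;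
only the common root moves along one edge. -/
lemma lolVal_shift {N : ℕ} (q₁ t₁ q₂ t₂ : ℕ) (hN : N = q₁ + t₁ + q₂ + t₂ + 2) :
    lolVal N (q₁ + 1) t₁ + lolVal N q₂ t₂ = lolVal N q₁ t₁ + lolVal N (q₂ + 1) t₂ := by
  subst hN
  simp only [lolVal, lolInner, lolTrans]
  push_cast
  ring

/-- The length of the path between the cycles may be distributed arbitrarily over the two
lollipops. -/
lemma lolVal_add_eq {N : ℕ} (q₁ t₁ : ℕ) : ∀ q₂ t₂ : ℕ, N = q₁ + 1 + t₁ + q₂ + t₂ + 1 →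
    lolVal N (q₁ + 1) t₁ + lolVal N q₂ t₂ = lolVal N 1 t₁ + lolVal N (q₁ + q₂) t₂ := by
  induction q₁ with
  | zero => intro q₂ t₂ _; simp
  | succ q ih =>
    intro q₂ t₂ hN
    rw [lolVal_shift (q + 1) t₁ q₂ t₂ (by omega), ih (q₂ + 1) t₂ (by omega),
      show q + (q₂ + 1) = q + 1 + q₂ by ring]

/-! ### The Wiener index and the extremal graph -/

namespace SimpleGraph

/-- Twice the sum over unordered pairs is the sum over ordered pairs. -/
lemma two_mul_sum_sym2 {V : Type*} [Fintype V] [DecidableEq V] (F : Sym2 V → ℕ)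
    (hF : ∀ x, F s(x, x) = 0) : 2 * ∑ e, F e = ∑ x, ∑ y, F s(x, y) := by
  rw [← Fintype.sum_prod_type' (fun x y => F s(x, y)),
    ← Finset.sum_fiberwise (Finset.univ : Finset (V × V)) (fun p => s(p.1, p.2)), Finset.mul_sum]
  refine Finset.sum_congr rfl fun e _ => ?_
  have : ∀ p ∈ (Finset.univ : Finset (V × V)).filter (fun p => s(p.1, p.2) = e),
      F s(p.1, p.2) = F e := by
    intro p hp
    rw [(Finset.mem_filter.mp hp).2]
  rw [Finset.sum_congr rfl this, Finset.sum_const, smul_eq_mul]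
  induction e using Sym2.ind with
  | _ a b =>
    by_cases hab : a = b
    · subst hab
      simp [hF]
    · congr 1
      have : (Finset.univ : Finset (V × V)).filter (fun p => s(p.1, p.2) = s(a, b)) =
          {(a, b), (b, a)} := by
        ext ⟨x, y⟩
        simp
      rw [this, Finset.card_pair]
      intro h
      exact hab (congrArg Prod.fst h)

lemma two_mul_wienerIndex {V : Type*} [Fintype V] [DecidableEq V] (G : SimpleGraph V) :
    (2 * G.wienerIndex : ℚ) = ∑ x, ∑ y, G.qdist x y := by
  have := two_mul_sum_sym2 (Sym2.lift ⟨G.dist, fun _ _ => G.dist_comm⟩) (by simp)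
  simp only [Sym2.lift_mk] at this
  unfold wienerIndex qdist
  exact_mod_cast this

lemma IsLollipop.nonempty_iso_cycleGraph {V : Type*} {G : SimpleGraph V} {pos : V → ℕ} {c t : ℕ}
    (h : G.IsLollipop pos c 0 t) : Nonempty (G ≃g cycleGraph (t + 2)) := by
  have hp : IsPos pos c (t + 2) := by simpa using h.isPos
  refine ⟨⟨hp.equivFin, fun {x y} => ?_⟩⟩
  have hx := hp.le x
  have hy := hp.le y
  have hx' := hp.lt x
  have hy' := hp.lt y
  rw [h.adj, cycleGraph_adj', Fin.val_sub, Fin.val_sub, hp.equivFin_val, hp.equivFin_val]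
  unfold ChordAdj
  have mod_eq : ∀ i j : ℕ, i < t + 2 → j < t + 2 →
      ((t + 2 - i + j) % (t + 2) = 1 ↔ (i + 1 = j ∨ (i = t + 1 ∧ j = 0))) := by
    intro i j hi hj
    rcases Nat.lt_or_ge j i with hlt | hge
    · rw [Nat.mod_eq_of_lt (by omega)]
      omega
    · rw [show t + 2 - i + j = (j - i) + (t + 2) by omega, Nat.add_mod_right,
        Nat.mod_eq_of_lt (by omega)]
      omega
  rw [mod_eq _ _ (by omega) (by omega), mod_eq _ _ (by omega) (by omega)]
  omega

/-- Two cycles on `t₁ + 2` and `t₂ + 2` vertices joined by a path with `r` edges, the vertices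
being labelled along the path. -/
def twoCycles (t₁ r t₂ : ℕ) (n : ℕ) : SimpleGraph (Fin n) where
  Adj i j := ChordAdj i j 0 (t₁ + 1) ∨ ChordAdj i j (t₁ + 1 + r) (t₁ + 1 + r + t₂ + 1)
  symm := ⟨by unfold ChordAdj; intro i j h; omega⟩
  loopless := ⟨by unfold ChordAdj; intro i h; omega⟩

lemma twoCycles_adj {t₁ r t₂ n : ℕ} {i j : Fin n} : (twoCycles t₁ r t₂ n).Adj i j ↔
    ChordAdj i j 0 (t₁ + 1) ∨ ChordAdj i j (t₁ + 1 + r) (t₁ + 1 + r + t₂ + 1) := Iff.rfl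

lemma isPos_val (n : ℕ) : IsPos (fun x : Fin n => (x : ℕ)) 0 n where
  inj := Fin.val_injective
  le _ := Nat.zero_le _
  lt x := by simp
  surj i _ h := ⟨⟨i, by omega⟩, rfl⟩

section

variable {t₁ r t₂ n : ℕ}

lemma twoCycles_left (hn : n = t₁ + r + t₂ + 3) :
    ((twoCycles t₁ r t₂ n).induce {x : Fin n | (x : ℕ) ≤ t₁ + 1}).IsLollipop (fun x => (x : Fin n))
      0 0 t₁ where
  isPos := (isPos_val n).restrict _ le_rfl (by omega) fun x => by
    simp only [Set.mem_ofPred_eq]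
    omega
  adj x y := by
    have hx : ((x : Fin n) : ℕ) ≤ t₁ + 1 := x.2
    have hy : ((y : Fin n) : ℕ) ≤ t₁ + 1 := y.2
    rw [induce_adj, twoCycles_adj]
    unfold ChordAdj
    omega

lemma twoCycles_right (hn : n = t₁ + r + t₂ + 3) :
    ((twoCycles t₁ r t₂ n).induce {x : Fin n | t₁ + 1 ≤ (x : ℕ)}).IsLollipop (fun x => (x : Fin n))
      (t₁ + 1) r t₂ where
  isPos := (isPos_val n).restrict _ (by omega) (by omega) fun x => by
    have := x.isLt
    simp only [Set.mem_ofPred_eq]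
    omega
  adj x y := by
    have hx : t₁ + 1 ≤ ((x : Fin n) : ℕ) := x.2
    have hy : t₁ + 1 ≤ ((y : Fin n) : ℕ) := y.2
    rw [induce_adj, twoCycles_adj]
    unfold ChordAdj
    omega

lemma twoCycles_last (hn : n = t₁ + r + t₂ + 3) :
    ((twoCycles t₁ r t₂ n).induce {x : Fin n | t₁ + 1 + r ≤ (x : ℕ)}).IsLollipop (fun x => (x : Fin n))
      (t₁ + 1 + r) 0 t₂ where
  isPos := (isPos_val n).restrict _ (by omega) (by omega) fun x => by
    have := x.isLt
    simp only [Set.mem_ofPred_eq]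
    omega
  adj x y := by
    have hx : t₁ + 1 + r ≤ ((x : Fin n) : ℕ) := x.2
    have hy : t₁ + 1 + r ≤ ((y : Fin n) : ℕ) := y.2
    rw [induce_adj, twoCycles_adj]
    unfold ChordAdj
    omega

lemma twoCycles_isSplit (v : Fin n) (hv : (v : ℕ) = t₁ + 1) :
    (twoCycles t₁ r t₂ n).IsSplit {x : Fin n | (x : ℕ) ≤ t₁ + 1} {x : Fin n | t₁ + 1 ≤ (x : ℕ)} v where
  mem_left := hv.le
  mem_right := hv.ge
  cover x := le_total (x : ℕ) (t₁ + 1)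
  inter x hx hx' := Fin.ext (by rw [hv]; exact le_antisymm hx hx')
  adj x y hxy := by
    rw [twoCycles_adj] at hxy
    unfold ChordAdj at hxy
    simp only [Set.mem_ofPred_eq]
    omega

lemma twoCycles_connected (hn : n = t₁ + r + t₂ + 3) : (twoCycles t₁ r t₂ n).Connected := by
  have : Nonempty (Fin n) := ⟨⟨0, by omega⟩⟩
  have key : ∀ x : Fin n, (twoCycles t₁ r t₂ n).Reachable ⟨0, by omega⟩ x := by
    intro x
    refine reachable_of_consecutive (pos := fun x : Fin n => (x : ℕ)) Fin.val_injective ?_ x _ _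
      (by simp) fun i _ hi => ⟨⟨i, by omega⟩, rfl⟩
    intro a b hab
    rw [twoCycles_adj]
    unfold ChordAdj
    omega
  exact ⟨fun x y => (key x).symm.trans (key y)⟩

lemma twoCycles_numBlocks (hn : n = t₁ + r + t₂ + 3) :
    (twoCycles t₁ r t₂ n).numBlocks = r + 2 := by
  classical
  rw [(twoCycles_isSplit (⟨t₁ + 1, by omega⟩ : Fin n) rfl).numBlocks_eq,
    (twoCycles_left hn).isNonseparable.numBlocks, (IsLollipop.bounds r (twoCycles_right hn)).1]
  ring

/-- At the junction `t₁ + 1` the graph splits into a cycle and a lollipop carrying the whole path,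
to which the lower bounds for lollipops apply. -/
lemma le_twoCycles_sum (hn : n = t₁ + r + t₂ + 3) :
    lolVal n 1 t₁ + lolVal n (r + 1) t₂ ≤ ∑ x, ∑ y, (twoCycles t₁ r t₂ n).qdist x y := by
  classical
  have hs : (twoCycles t₁ r t₂ n).IsSplit _ _ _ :=
    twoCycles_isSplit (⟨t₁ + 1, by omega⟩ : Fin n) rfl
  have h1 := hs.quadSum_one_eq (twoCycles_connected hn)
  obtain ⟨-, -, a3⟩ := IsLollipop.bounds 0 (twoCycles_left hn)
  obtain ⟨-, b2, b3⟩ := IsLollipop.bounds r (twoCycles_right hn)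
  have a2 := (twoCycles_left hn).le_sum_dist ⟨_, hs.mem_left⟩
  have b2 := b2 ⟨_, hs.mem_right⟩ rfl
  rw [(twoCycles_left hn).isPos.card_eq, (twoCycles_right hn).isPos.card_eq] at h1
  rw [← lolTrans_one] at a2
  have h2 := mul_le_mul_of_nonneg_left a2 (show (0 : ℚ) ≤ 2 * (r + t₂ + 1) by positivity)
  have h3 := mul_le_mul_of_nonneg_left b2 (show (0 : ℚ) ≤ 2 * (t₁ + 1) by positivity)
  have e : ∑ x, ∑ y, (twoCycles t₁ r t₂ n).qdist x y =
      quadSum (twoCycles t₁ r t₂ n).qdist (fun _ => 1) := by simp [quadSum]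
  have hnq : (n : ℚ) = t₁ + r + t₂ + 3 := by exact_mod_cast hn
  rw [e, h1]
  simp only [lolVal, hnq]
  push_cast at h2 h3 a3 b3 ⊢
  linarith

lemma twoCycles_isCyclePathCycle (hn : n = t₁ + r + t₂ + 3) :
    (twoCycles t₁ r t₂ n).IsCyclePathCycle (t₁ + 2) (r + 1) (t₂ + 2) := by
  let G := twoCycles t₁ r t₂ n
  let P : G.Subgraph :=
    (⊤ : G.Subgraph).induce {x : Fin n | t₁ + 1 ≤ (x : ℕ) ∧ (x : ℕ) ≤ t₁ + 1 + r}
  let A : G.Subgraph := (⊤ : G.Subgraph).induce {x : Fin n | (x : ℕ) ≤ t₁ + 1}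
  let B : G.Subgraph := (⊤ : G.Subgraph).induce {x : Fin n | t₁ + 1 + r ≤ (x : ℕ)}
  have vA : ∀ x, x ∈ A.verts ↔ (x : ℕ) ≤ t₁ + 1 := fun _ => Iff.rfl
  have vP : ∀ x, x ∈ P.verts ↔ t₁ + 1 ≤ (x : ℕ) ∧ (x : ℕ) ≤ t₁ + 1 + r := fun _ => Iff.rfl
  have vB : ∀ x, x ∈ B.verts ↔ t₁ + 1 + r ≤ (x : ℕ) := fun _ => Iff.rfl
  have aA : ∀ x y, A.Adj x y ↔ x ∈ A.verts ∧ y ∈ A.verts ∧ G.Adj x y := fun _ _ => Iff.rfl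
  have aP : ∀ x y, P.Adj x y ↔ x ∈ P.verts ∧ y ∈ P.verts ∧ G.Adj x y := fun _ _ => Iff.rfl
  have aB : ∀ x y, B.Adj x y ↔ x ∈ B.verts ∧ y ∈ B.verts ∧ G.Adj x y := fun _ _ => Iff.rfl
  have aG : ∀ x y : Fin n, G.Adj x y → (x ∈ A.verts ∧ y ∈ A.verts) ∨
      (x ∈ P.verts ∧ y ∈ P.verts) ∨ (x ∈ B.verts ∧ y ∈ B.verts) := by
    intro x y hxy
    have hxy := twoCycles_adj.mp hxy
    unfold ChordAdj at hxy
    rw [vA, vA, vP, vP, vB, vB]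
    omega
  have hpos : IsPos (fun x : P.verts => ((x : Fin n) : ℕ)) (t₁ + 1) (r + 1) :=
    (isPos_val n).restrict P.verts (by omega) (by omega) fun x => by
      rw [vP]
      omega
  have hφ : ∀ {x y : P.verts},
      (pathGraph (r + 1)).Adj (hpos.equivFin x) (hpos.equivFin y) ↔ P.coe.Adj x y := by
    intro x y
    have hx := (vP x).mp x.2
    have hy := (vP y).mp y.2
    rw [pathGraph_adj, hpos.equivFin_val, hpos.equivFin_val, Subgraph.coe_adj, aP, vP, vP,
      twoCycles_adj]
    unfold ChordAdj
    omega
  clear_value P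
  have hA : Nonempty (A.coe ≃g cycleGraph (t₁ + 2)) := by
    have := (twoCycles_left hn).nonempty_iso_cycleGraph
    rwa [induce_eq_coe_induce_top] at this
  have hB : Nonempty (B.coe ≃g cycleGraph (t₂ + 2)) := by
    have := (twoCycles_last hn).nonempty_iso_cycleGraph
    rwa [induce_eq_coe_induce_top] at this
  clear_value A B
  let u : Fin n := ⟨t₁ + 1, by omega⟩
  let v : Fin n := ⟨t₁ + 1 + r, by omega⟩
  have eu : ∀ x, x = u ↔ (x : ℕ) = t₁ + 1 := fun x => Fin.ext_iff
  have ev : ∀ x, x = v ↔ (x : ℕ) = t₁ + 1 + r := fun x => Fin.ext_iff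
  have hu : u ∈ P.verts := by rw [vP]; simp [u]
  have hv : v ∈ P.verts := by rw [vP]; simp [v]
  -- An edge in the intersection would need two common vertices, so comparing vertex sets suffices.
  have single : ∀ (H K : G.Subgraph) (w : Fin n), (∀ x, x ∈ H.verts ∧ x ∈ K.verts ↔ x = w) →
      H ⊓ K = G.singletonSubgraph w := by
    intro H K w h
    ext x y
    · exact h x
    · simp only [Subgraph.inf_adj, singletonSubgraph_adj, Pi.bot_apply, Prop.bot_eq_false,
        iff_false]
      rintro ⟨h1, h2⟩
      have hx := (h x).mp ⟨H.edge_vert h1, K.edge_vert h2⟩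
      have hy := (h y).mp ⟨H.edge_vert h1.symm, K.edge_vert h2.symm⟩
      exact h1.ne (hx.trans hy.symm)
  refine ⟨A, P, B, ⟨u, hu⟩, ⟨v, hv⟩, ⟨hpos.equivFin, hφ⟩, hA, hB, ?_, ?_,
    ⟨rfl, single _ _ _ fun x => ?_⟩, ?_, single _ _ _ fun x => ?_⟩
  · change t₁ + 1 - (t₁ + 1) = 0
    omega
  · change t₁ + 1 + r - (t₁ + 1) + 1 = r + 1
    omega
  · rw [vA, vP, eu]
    omega
  · ext x y
    · rw [Subgraph.verts_sup, Subgraph.verts_sup, Set.mem_union, Set.mem_union, vA, vP, vB,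
        Subgraph.verts_top]
      simp only [Set.mem_univ, true_iff]
      omega
    · rw [Subgraph.sup_adj, Subgraph.sup_adj, aA, aP, aB, Subgraph.top_adj]
      change G.Adj x y ↔ _
      constructor
      · intro h
        rcases aG x y h with ⟨h1, h2⟩ | ⟨h1, h2⟩ | ⟨h1, h2⟩
        · exact Or.inl (Or.inl ⟨h1, h2, h⟩)
        · exact Or.inl (Or.inr ⟨h1, h2, h⟩)
        · exact Or.inr ⟨h1, h2, h⟩
      · rintro ((⟨_, _, h⟩ | ⟨_, _, h⟩) | ⟨_, _, h⟩) <;> exact h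
  · rw [Subgraph.verts_sup, Set.mem_union, vA, vP, vB, ev]
    omega

end

end SimpleGraph

/-! ### The maximum -/

theorem theorem1 (n p : ℕ) (hp : 1 < p) (hpn : p < n) :
    ∃ a b : ℕ, 2 ≤ a ∧ 2 ≤ b ∧ a + b = n - p + 3 ∧
      ∃ G : SimpleGraph (Fin n), G.IsCyclePathCycle a (p - 1) b ∧
        G.Connected ∧ G.numBlocks = p ∧
        ∀ H : SimpleGraph (Fin n), H.Connected → H.numBlocks = p →
          H.wienerIndex ≤ G.wienerIndex := by
  -- The cycle lengths are `s + 2` and `t + 2` with `s + t = n - 1 - p`; the best distribution of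
  -- these spare vertices is chosen by maximising the bound itself.
  obtain ⟨s, hs, hmax⟩ := Finset.exists_max_image (Finset.range (n - p))
    (fun s => lolVal n 1 s + lolVal n (p - 1) (n - 1 - p - s)) ⟨0, by simp; omega⟩
  rw [Finset.mem_range] at hs
  obtain ⟨r, rfl⟩ := Nat.exists_eq_add_of_le hp
  set t := n - 1 - (1 + 1 + r) - s with ht
  have hn : n = s + r + t + 3 := by omega
  refine ⟨s + 2, t + 2, by omega, by omega, by omega, SimpleGraph.twoCycles s r t n, ?_,
    SimpleGraph.twoCycles_connected hn, ?_, ?_⟩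
  · have := SimpleGraph.twoCycles_isCyclePathCycle hn
    rwa [show 1 + 1 + r - 1 = r + 1 by omega]
  · rw [SimpleGraph.twoCycles_numBlocks hn]
    omega
  · intro H hH hHp
    obtain ⟨q₁, t₁, q₂, t₂, h1, h2, h3, h4, h5⟩ := H.exists_sum_dist_le hH (by omega)
    rw [Fintype.card_fin] at h4 h5
    obtain ⟨q, rfl⟩ : ∃ q, q₁ = q + 1 := ⟨q₁ - 1, by omega⟩
    -- Sliding the root to the first cycle brings the bound for `H` into the maximised form.
    rw [lolVal_add_eq q t₁ q₂ t₂ (by omega), show q + q₂ = r + 1 by omega] at h5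
    have h6 := hmax t₁ (Finset.mem_range.mpr (by omega))
    rw [show 1 + 1 + r - 1 = r + 1 by omega, show n - 1 - (1 + 1 + r) - t₁ = t₂ by omega] at h6
    have h7 := SimpleGraph.le_twoCycles_sum hn
    rw [← SimpleGraph.two_mul_wienerIndex] at h5 h7
    have : (H.wienerIndex : ℚ) ≤ (SimpleGraph.twoCycles s r t n).wienerIndex := by linarith
    exact_mod_cast this
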